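/- Notation. For a compact convex set $K\subset\mathbb R^n$ with the origin in its interior let $h_K(y)=\max\{x\cdot y:x\in K\}$ be its support function, $\rho_K(x)=\max\{\lambda:\lambda x\in K\}$ (for $x\ne 0$) its radial function, $K^*=\{y: y\cdot x\le 1\text{ for all }x\in K\}$ its polar body, and $\mathcal E(K)=-\int_{S^{n-1}}\log h_K(v)\,dv$, where $dv$ is spherical Lebesgue measure. For $p\neq0$, two such sets $K,Q$ and real $t$ with $|t|$ small, let $K\hat+_p t\cdot Q=(K^*+_p t\cdot Q^*)^*$, where $K^*+_p t\cdot Q^*=\{x: x\cdot v\le (h_{K^*}(v)^p+t\,h_{Q^*}(v)^p)^{1/p}\text{ for all }v\in S^{n-1}\}$. The $L_p$ Aleksandrov integral curvature $J_p(K,\cdot)$ is the unique Borel measure on $S^{n-1}$ such that $$\left.\frac{d}{dt}\mathcal E(K\hat+_p t\cdot Q)\right|_{t=0}=\frac1p\int_{S^{n-1}}\rho_Q(u)^{-p}\,dJ_p(K,u)$$ for every compact convex set $Q\subset\mathbb R^n$ with the origin in its interior. Theorem. Let $-1<p<0$ and let $\mu$ be a non-zero, finite, even Borel measure on $S^{n-1}$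 that is discrete, i.e. concentrated on a finite set. There exists an origin-symmetric polytope $K\subset\mathbb R^n$ with non-empty interior such that $\mu=J_p(K,\cdot)$ if and only if $\mu$ is not concentrated on any great subsphere, i.e. $\mu(\{u\in S^{n-1}:u\cdot w\neq0\})>0$ for every $w\in\mathbb R^n\setminus\{0\}$. -/

import Mathlib

open MeasureTheory

noncomputable section

namespace LpAleksandrov

/-- Euclidean space `ℝⁿ`. -/
abbrev E (n : ℕ) : Type := EuclideanSpace ℝ (Fin n)

/-- The unit sphere `S^{n-1}` of `ℝⁿ`. -/
abbrev S (n : ℕ) : Type := Metric.sphere (0 : E n) 1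

/-- Convex bodies containing the origin in their interior (the class `𝒦_oⁿ`). -/
structure IsBodyO {n : ℕ} (K : Set (E n)) : Prop where
  convex : Convex ℝ K
  isCompact : IsCompact K
  zero_mem_interior : (0 : E n) ∈ interior K

/-- Origin-symmetric convex bodies: compact convex sets with non-empty interior that satisfy
`K = -K` (the class `𝒦_eⁿ`). -/
structure IsBodyE {n : ℕ} (K : Set (E n)) : Prop where
  convex : Convex ℝ K
  isCompact : IsCompact K
  interior_nonempty : (interior K).Nonempty
  symmetric : ∀ x ∈ K, -x ∈ K

/-- A polytope is the convex hull of finitely many points. -/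
def IsPolytope {n : ℕ} (K : Set (E n)) : Prop :=
  ∃ F : Finset (E n), K = convexHull ℝ (F : Set (E n))

/-- The support function `h_K(y) = max {x · y : x ∈ K}`. -/
def supportFn {n : ℕ} (K : Set (E n)) (y : E n) : ℝ :=
  sSup ((fun x : E n => inner ℝ x y) '' K)

/-- The radial function `ρ_K(x) = max {r : r x ∈ K}`. -/
def radialFn {n : ℕ} (K : Set (E n)) (x : E n) : ℝ :=
  sSup {r : ℝ | r • x ∈ K}

/-- The polar body `K^*`. -/
def polarBody {n : ℕ} (K : Set (E n)) : Set (E n) :=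
  {y | ∀ x ∈ K, inner ℝ y x ≤ 1}

/-- The Wulff shape generated by a function on the sphere. -/
def wulffShape {n : ℕ} (f : S n → ℝ) : Set (E n) :=
  {x | ∀ v : S n, inner ℝ x (v : E n) ≤ f v}

/-- The `L_p` combination `K +_p t·L`, for `p ≠ 0`: the Wulff shape of `(h_K^p + t h_L^p)^{1/p}`. -/
def lpCombination {n : ℕ} (p : ℝ) (K : Set (E n)) (t : ℝ) (L : Set (E n)) : Set (E n) :=
  wulffShape fun v => (supportFn K v ^ p + t * supportFn L v ^ p) ^ (1 / p)

/-- The harmonic `L_p` combination `K +̂_p t·L = (K^* +_p t·L^*)^*`. -/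
def harmonicCombination {n : ℕ} (p : ℝ) (K : Set (E n)) (t : ℝ) (L : Set (E n)) : Set (E n) :=
  polarBody (lpCombination p (polarBody K) t (polarBody L))

/-- The entropy integral `ℰ(K) = -∫_{S^{n-1}} log h_K(v) dv`, where `dv` is spherical Lebesgue
measure (of total mass `n ω_n`). -/
def entropy {n : ℕ} (K : Set (E n)) : ℝ :=
  -∫ v : S n, Real.log (supportFn K v) ∂((volume : Measure (E n)).toSphere)

/-- `ν` is the `L_p` Aleksandrov integral curvature `J_p(K, ·)` of `K`, for `p ≠ 0`: the Borel
measure on the sphere with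
`d/dt ℰ(K +̂_p t·Q) |_{t=0} = (1/p) ∫ ρ_Q(u)^{-p} dν(u)` for every convex body `Q` containing the
origin in its interior. -/
def IsLpIntegralCurvature {n : ℕ} (p : ℝ) (K : Set (E n)) (ν : Measure (S n)) : Prop :=
  ∀ Q : Set (E n), IsBodyO Q →
    HasDerivAt (fun t : ℝ => entropy (harmonicCombination p K t Q))
      (1 / p * ∫ u : S n, radialFn Q u ^ (-p) ∂ν) 0

/-- A measure on the sphere is even if antipodal Borel sets have equal measure. -/
def IsEvenMeasure {n : ℕ} (μ : Measure (S n)) : Prop :=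
  ∀ ω : Set (S n), MeasurableSet ω → μ ((fun u : S n => -u) ⁻¹' ω) = μ ω

/-- A measure on the sphere is discrete if it is concentrated on finitely many points. -/
def IsDiscreteMeasure {n : ℕ} (μ : Measure (S n)) : Prop :=
  ∃ F : Set (S n), F.Finite ∧ μ Fᶜ = 0

/-- The great subsphere `{u ∈ S^{n-1} : u · w = 0}`, for `w ≠ 0`. -/
def greatSubsphere {n : ℕ} (w : E n) : Set (S n) :=
  {u | inner ℝ (u : E n) w = 0}

end LpAleksandrov

end

/-!
With `⟪u, v⟫₊ = max ⟪u, v⟫ 0`, the entropy `ℰ(K +̂_p t·Q)` is `1 / p` times the integral over `v` of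
`log (⨆ u, ⟪u, v⟫₊ ^ (-p) * (ρ_K(u) ^ (-p) + t * ρ_Q(u) ^ (-p)))`. Differentiating under the
integral, only the maximising `u` contributes. For a polytope it is the direction of the vertex
exposed by `v`, so `J_p(K, ·)` puts at the direction of each vertex `x` the mass `‖x‖ ^ p` times the
spherical measure of the normal cone of `x`.

Necessity: if `μ` were carried by `w^⊥`, testing it against the unit balls of the norms `‖x‖` and
`‖x‖ + |⟪x, w⟫|` would give the same integrals; but some vertex with a normal cone of positive
measure is not orthogonal to `w`.

Sufficiency: put `q = -p ∈ (0, 1)` and let `± e_i` be the atoms of `μ`, of mass `m_i`. Over `a ≥ 0`,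
minimise `∫ log (max_i a_i |⟪e_i, v⟫| ^ q) dv - |S^{n-1}| log (∑ m_i a_i)`. If some `a_i` vanished,
raising it to `ε` would raise the integral by only `O(ε ^ s)` with `1 < s < 1 / q`, because
`|⟪e_j, v⟫| ^ (-q s)` is integrable, while the subtracted term grows linearly. So the minimiser is
positive, and its Euler–Lagrange equations say that, after scaling, the polytope with vertices
`± a_i ^ (1 / q) e_i` has `J_p` equal to `μ`.
-/

noncomputable section

namespace LpAleksandrov

open Filter Topology Set
open scoped ENNReal

section CompactSup

variable {X Y : Type*} [TopologicalSpace X] [CompactSpace X] [TopologicalSpace Y]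

theorem le_iSup_of_continuous {f : X → ℝ} (hf : Continuous f) (x : X) : f x ≤ ⨆ y, f y :=
  le_ciSup (isCompact_range hf).bddAbove x

theorem exists_eq_iSup_of_continuous [Nonempty X] {f : X → ℝ} (hf : Continuous f) :
    ∃ x, f x = ⨆ y, f y :=
  (isCompact_range hf).sSup_mem (range_nonempty f)

theorem continuous_iSup_of_compact {f : Y → X → ℝ} (hf : Continuous fun z : Y × X => f z.1 z.2) :
    Continuous fun y => ⨆ x, f y x := by
  simpa only [image_univ, iSup] using isCompact_univ.continuous_sSup (f := f) hf

theorem abs_iSup_sub_iSup_le {f g : X → ℝ} [Nonempty X] (hf : Continuous f) (hg : Continuous g)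
    {C : ℝ} (h : ∀ x, |f x - g x| ≤ C) : |(⨆ x, f x) - ⨆ x, g x| ≤ C := by
  rw [abs_sub_le_iff, sub_le_iff_le_add, sub_le_iff_le_add]
  constructor
  · refine ciSup_le fun x => ?_
    linarith [le_iSup_of_continuous hg x, (abs_le.1 (h x)).2]
  · refine ciSup_le fun x => ?_
    linarith [le_iSup_of_continuous hf x, (abs_le.1 (h x)).1]

theorem iSup_eq_of_forall_lt {f : X → ℝ} (hf : Continuous f) {x₀ : X}
    (hx₀ : ∀ y, y ≠ x₀ → f y < f x₀) : ⨆ y, f y = f x₀ := by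
  have : Nonempty X := ⟨x₀⟩
  refine le_antisymm (ciSup_le fun y => ?_) (le_iSup_of_continuous hf x₀)
  by_cases hy : y = x₀
  · rw [hy]
  · exact (hx₀ y hy).le

theorem exists_forall_abs_le_of_continuous {f : X → ℝ} (hf : Continuous f) :
    ∃ M, 0 < M ∧ ∀ x, |f x| ≤ M := by
  obtain ⟨M, hM⟩ := (isCompact_range hf).isBounded.exists_norm_le
  exact ⟨max M 1, by positivity, fun x => (hM _ ⟨x, rfl⟩).trans (le_max_left _ _)⟩

theorem tendsto_of_tendsto_comp_of_forall_ne {α : Type*} {l : Filter α} {u : α → X} {g : X → ℝ}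
    (hg : Continuous g) {x₀ : X} (hx₀ : ∀ y, y ≠ x₀ → g y ≠ g x₀)
    (h : Tendsto (fun a => g (u a)) l (𝓝 (g x₀))) : Tendsto u l (𝓝 x₀) := by
  refine le_nhds_of_unique_clusterPt fun y hy => ?_
  by_contra hne
  have hcluster : ClusterPt (g y) (map (g ∘ u) l) := by
    rw [← map_map]
    exact hy.map hg.continuousAt tendsto_map
  exact hx₀ y hne (t2_iff_nhds.1 inferInstance (hcluster.mono h))

/-- **Danskin's theorem** for affine families with a unique maximiser. -/
theorem hasDerivAt_iSup_add_mul {g h : X → ℝ} (hg : Continuous g) (hh : Continuous h) {x₀ : X}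
    (hx₀ : ∀ y, y ≠ x₀ → g y < g x₀) :
    HasDerivAt (fun t : ℝ => ⨆ y, (g y + t * h y)) (h x₀) 0 := by
  have : Nonempty X := ⟨x₀⟩
  have hcont (t : ℝ) : Continuous fun y => g y + t * h y := by fun_prop
  choose x hx using fun t : ℝ => exists_eq_iSup_of_continuous (hcont t)
  obtain ⟨M, -, hM⟩ := exists_forall_abs_le_of_continuous hh
  have hmax (y : X) : g y ≤ g x₀ := by
    simpa only [iSup_eq_of_forall_lt hg hx₀] using le_iSup_of_continuous hg y
  have hlower (t : ℝ) : g x₀ + t * h x₀ ≤ g (x t) + t * h (x t) :=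
    (le_iSup_of_continuous (hcont t) x₀).trans (hx t).ge
  have hxlim : Tendsto x (𝓝 0) (𝓝 x₀) := by
    refine tendsto_of_tendsto_comp_of_forall_ne hg (fun y hy => (hx₀ y hy).ne) ?_
    have hbelow : Tendsto (fun t : ℝ => g x₀ - |t| * (2 * M)) (𝓝 0) (𝓝 (g x₀)) := by
      have : Continuous fun t : ℝ => g x₀ - |t| * (2 * M) := by fun_prop
      simpa using this.tendsto 0
    refine tendsto_of_tendsto_of_tendsto_of_le_of_le hbelow tendsto_const_nhds (fun t => ?_)
      fun t => hmax (x t)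
    have hdiff : t * (h (x t) - h x₀) ≤ |t| * (2 * M) := by
      refine (le_abs_self _).trans ?_
      rw [abs_mul]
      gcongr
      linarith [abs_sub (h (x t)) (h x₀), hM (x t), hM x₀]
    linarith [hlower t]
  have hlittle : (fun t : ℝ => t * (h (x t) - h x₀)) =o[𝓝 0] fun t => t := by
    have : (fun t : ℝ => h (x t) - h x₀) =o[𝓝 0] fun _ => (1 : ℝ) := by
      rw [Asymptotics.isLittleO_one_iff]
      simpa using ((hh.tendsto x₀).comp hxlim).sub_const (h x₀)
    simpa using (Asymptotics.isBigO_refl (fun t : ℝ => t) (𝓝 0)).mul_isLittleO this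
  rw [hasDerivAt_iff_isLittleO]
  simp only [zero_mul, add_zero, sub_zero, smul_eq_mul, iSup_eq_of_forall_lt hg hx₀, ← hx]
  refine Asymptotics.IsBigO.trans_isLittleO (.of_norm_le fun t => ?_) hlittle
  rw [Real.norm_eq_abs, abs_of_nonneg (by linarith [hlower t])]
  linarith [hmax (x t)]

end CompactSup

theorem abs_log_sub_log_le {a b c : ℝ} (hc : 0 < c) (ha : c ≤ a) (hb : c ≤ b) :
    |Real.log a - Real.log b| ≤ |a - b| / c := by
  wlog hab : b ≤ a generalizing a b
  · rw [abs_sub_comm, abs_sub_comm a]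
    exact this hb ha (le_of_not_ge hab)
  have hb₀ := hc.trans_le hb
  rw [abs_of_nonneg (sub_nonneg.2 (Real.log_le_log hb₀ hab)), abs_of_nonneg (sub_nonneg.2 hab),
    ← Real.log_div (hc.trans_le ha).ne' hb₀.ne']
  calc Real.log (a / b) ≤ a / b - 1 := Real.log_le_sub_one_of_pos (div_pos (hc.trans_le ha) hb₀)
    _ = (a - b) / b := by field_simp
    _ ≤ (a - b) / c := by gcongr

section Variation

variable {V X : Type*} [TopologicalSpace V] [TopologicalSpace X] [CompactSpace X]

theorem continuous_iSup_add_mul {g h : V → X → ℝ} (hg : Continuous fun z : V × X => g z.1 z.2)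
    (hh : Continuous fun z : V × X => h z.1 z.2) :
    Continuous fun z : V × ℝ => ⨆ y, (g z.1 y + z.2 * h z.1 y) :=
  continuous_iSup_of_compact (f := fun (z : V × ℝ) y => g z.1 y + z.2 * h z.1 y) <|
    (hg.comp (by fun_prop : Continuous fun w : (V × ℝ) × X => (w.1.1, w.2))).add
      ((by fun_prop : Continuous fun w : (V × ℝ) × X => w.1.2).mul
        (hh.comp (by fun_prop : Continuous fun w : (V × ℝ) × X => (w.1.1, w.2))))

theorem lipschitzOnWith_log_iSup_add_mul [Nonempty X] {g h : X → ℝ} (hg : Continuous g)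
    (hh : Continuous h) {M c : ℝ} (hM : ∀ y, |h y| ≤ M) (hM₀ : 0 < M) (hc : 0 < c) {T : Set ℝ}
    (hT : ∀ t ∈ T, c ≤ ⨆ y, (g y + t * h y)) :
    LipschitzOnWith (Real.nnabs (M / c)) (fun t => Real.log (⨆ y, (g y + t * h y))) T := by
  refine LipschitzOnWith.of_dist_le_mul fun s hs t ht => ?_
  rw [Real.dist_eq, Real.dist_eq, Real.coe_nnabs, abs_of_pos (div_pos hM₀ hc), div_mul_eq_mul_div]
  refine (abs_log_sub_log_le hc (hT s hs) (hT t ht)).trans ?_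
  gcongr
  refine abs_iSup_sub_iSup_le (by fun_prop) (by fun_prop) fun y => ?_
  rw [add_sub_add_left_eq_sub, ← sub_mul, abs_mul, mul_comm]
  exact mul_le_mul_of_nonneg_right (hM y) (abs_nonneg _)

variable [CompactSpace V]

theorem exists_forall_pos_le_iSup_add_mul [Nonempty X] {g h : V → X → ℝ}
    (hg : Continuous fun z : V × X => g z.1 z.2) (hh : Continuous fun z : V × X => h z.1 z.2)
    (hpos : ∀ v, ∃ x, 0 < g v x) :
    ∃ ε > 0, ∃ c > 0, ∀ t ∈ Metric.ball (0 : ℝ) ε, ∀ v, c ≤ ⨆ y, (g v y + t * h v y) := by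
  have hgv (v : V) : Continuous (g v) := hg.comp (.prodMk_right v)
  have hhv (v : V) : Continuous (h v) := hh.comp (.prodMk_right v)
  obtain ⟨c, hc, hcle⟩ : ∃ c > 0, ∀ v, c ≤ ⨆ y, g v y := by
    cases isEmpty_or_nonempty V
    · exact ⟨1, one_pos, isEmptyElim⟩
    obtain ⟨v₀, -, hv₀⟩ := isCompact_univ.exists_isMinOn univ_nonempty
      (continuous_iSup_of_compact hg).continuousOn
    obtain ⟨x, hx⟩ := hpos v₀
    exact ⟨_, hx.trans_le (le_iSup_of_continuous (hgv v₀) x), fun v => hv₀ (mem_univ v)⟩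
  obtain ⟨M, hM₀, hM⟩ := exists_forall_abs_le_of_continuous hh
  refine ⟨c / (2 * M), by positivity, c / 2, by positivity, fun t ht v => ?_⟩
  have htM : |t| * M ≤ c / 2 := by
    rw [mem_ball_zero_iff, Real.norm_eq_abs, lt_div_iff₀ (by positivity)] at ht
    linarith
  have hclose : |(⨆ y, (g v y + t * h v y)) - ⨆ y, g v y| ≤ c / 2 := by
    refine abs_iSup_sub_iSup_le (by fun_prop) (by fun_prop) fun y => ?_
    rw [add_sub_cancel_left, abs_mul]
    exact (mul_le_mul_of_nonneg_left (hM (v, y)) (abs_nonneg t)).trans htM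
  linarith [(abs_le.1 hclose).1, hcle v]

variable [MeasurableSpace V] [BorelSpace V] {σ : Measure V} [IsFiniteMeasure σ]

/-- **Envelope theorem** for `∫ log sup`: differentiating under the integral sign, only the almost
everywhere unique maximiser contributes. -/
theorem hasDerivAt_integral_log_iSup_add_mul [Nonempty X] {g h : V → X → ℝ}
    (hg : Continuous fun z : V × X => g z.1 z.2) (hh : Continuous fun z : V × X => h z.1 z.2)
    (hpos : ∀ v, ∃ x, 0 < g v x) {x : V → X}
    (hx : ∀ᵐ v ∂σ, ∀ y, y ≠ x v → g v y < g v (x v)) :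
    HasDerivAt (fun t : ℝ => ∫ v, Real.log (⨆ y, (g v y + t * h v y)) ∂σ)
      (∫ v, h v (x v) / g v (x v) ∂σ) 0 := by
  have hgv (v : V) : Continuous (g v) := hg.comp (.prodMk_right v)
  have hhv (v : V) : Continuous (h v) := hh.comp (.prodMk_right v)
  have hsup := continuous_iSup_add_mul hg hh
  have hsup_left (t : ℝ) : Continuous fun v => ⨆ y, (g v y + t * h v y) :=
    hsup.comp (.prodMk_left t)
  obtain ⟨ε, hε, c, hc, hcle⟩ := exists_forall_pos_le_iSup_add_mul hg hh hpos
  obtain ⟨M, hM₀, hM⟩ := exists_forall_abs_le_of_continuous hh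
  have hsup_zero {v : V} (hv : ∀ y, y ≠ x v → g v y < g v (x v)) :
      ⨆ y, (g v y + 0 * h v y) = g v (x v) := by
    simp only [zero_mul, add_zero, iSup_eq_of_forall_lt (hgv v) hv]
  refine (hasDerivAt_integral_of_dominated_loc_of_lip
    (F := fun t v => Real.log (⨆ y, (g v y + t * h v y))) (bound := fun _ => M / c)
    (Metric.ball_mem_nhds 0 hε)
    (.of_forall fun t => (Real.measurable_log.comp (hsup_left t).measurable).aestronglyMeasurable)
    ?_ ?_ (ae_of_all _ fun v => lipschitzOnWith_log_iSup_add_mul (hgv v) (hhv v)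
      (fun y => hM (v, y)) hM₀ hc fun t ht => hcle t ht v) (integrable_const _) ?_).2
  · refine Continuous.integrable_of_hasCompactSupport ((hsup_left 0).log fun v => ?_)
      (.of_compactSpace _)
    exact (hc.trans_le (hcle 0 (Metric.mem_ball_self hε) v)).ne'
  · have hderiv : Measurable fun v => deriv (fun t => ⨆ y, (g v y + t * h v y)) 0 :=
      (measurable_deriv_with_param (f := fun v t => ⨆ y, (g v y + t * h v y)) hsup).comp
        measurable_prodMk_right
    refine ((hderiv.div (hsup_left 0).measurable).aestronglyMeasurable).congr ?_
    filter_upwards [hx] with v hv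
    rw [Pi.div_apply, (hasDerivAt_iSup_add_mul (hgv v) (hhv v) hv).deriv, hsup_zero hv]
  · filter_upwards [hx] with v hv
    simpa only [hsup_zero hv] using (hasDerivAt_iSup_add_mul (hgv v) (hhv v) hv).log
      (hc.trans_le (hcle 0 (Metric.mem_ball_self hε) v)).ne'

end Variation

section DominanceCell

variable {V ι : Type*}

/-- The cell of `V` on which the `i`-th function of the family `f` strictly dominates all others;
for linear functions on the sphere these are the spherical pieces of the normal fan of a
polytope. -/
def dominanceCell (f : ι → V → ℝ) (i : ι) : Set V :=
  {v | ∀ j, j ≠ i → f j v < f i v}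

theorem pairwise_disjoint_dominanceCell (f : ι → V → ℝ) :
    Pairwise (Function.onFun Disjoint (dominanceCell f)) := fun i j hij =>
  Set.disjoint_left.2 fun _ hi hj => (hi j hij.symm).asymm (hj i hij)

theorem isOpen_dominanceCell [TopologicalSpace V] [Finite ι] {f : ι → V → ℝ}
    (hf : ∀ i, Continuous (f i)) (i : ι) : IsOpen (dominanceCell f i) := by
  simp only [dominanceCell, ofPred_forall]
  exact isOpen_iInter_of_finite fun j => isOpen_iInter_of_finite fun _ => isOpen_lt (hf j) (hf i)

theorem exists_mem_dominanceCell [Finite ι] [Nonempty ι] {f : ι → V → ℝ} {v : V}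
    (hv : ∀ i j, i ≠ j → f i v ≠ f j v) : ∃ i, v ∈ dominanceCell f i := by
  obtain ⟨i, hi⟩ := Finite.exists_max (f · v)
  exact ⟨i, fun j hj => (hi j).lt_of_ne (hv j i hj)⟩

variable [MeasurableSpace V] {σ : Measure V}

theorem exists_ae_mem_dominanceCell [Finite ι] [Nonempty ι] {f : ι → V → ℝ}
    (hf : ∀ i j, i ≠ j → ∀ᵐ v ∂σ, f i v ≠ f j v) :
    ∃ i : V → ι, ∀ᵐ v ∂σ, v ∈ dominanceCell f (i v) := by
  have : ∀ᵐ v ∂σ, ∀ i j, i ≠ j → f i v ≠ f j v := by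
    simpa only [ae_all_iff] using hf
  exact skolem.1 (this.mono fun v hv => exists_mem_dominanceCell hv)

theorem integral_comp_dominanceCell_index [Fintype ι] [IsFiniteMeasure σ] {f : ι → V → ℝ}
    (hf : ∀ i, MeasurableSet (dominanceCell f i)) {i : V → ι}
    (hi : ∀ᵐ v ∂σ, v ∈ dominanceCell f (i v)) (c : ι → ℝ) :
    ∫ v, c (i v) ∂σ = ∑ j, σ.real (dominanceCell f j) * c j := by
  classical
  have hsum : ∀ᵐ v ∂σ, c (i v) = ∑ j, (dominanceCell f j).indicator (fun _ => c j) v := by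
    filter_upwards [hi] with v hv
    rw [Finset.sum_eq_single (i v) (fun j _ hj => indicator_of_notMem (fun hvj =>
      Set.disjoint_left.1 (pairwise_disjoint_dominanceCell f hj) hvj hv) _) (by simp),
      indicator_of_mem hv]
  rw [integral_congr_ae hsum,
    integral_finsetSum _ fun j _ => (integrable_const _).indicator (hf j)]
  simp only [integral_indicator_const _ (hf _), smul_eq_mul]

end DominanceCell

theorem abs_log_le_add_abs_log {x y : ℝ} (hx : 0 < x) (hxy : x ≤ y) :
    |Real.log y| ≤ y + |Real.log x| := by
  have hlower := Real.log_le_log hx hxy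
  have hupper := Real.log_le_self (hx.le.trans hxy)
  rw [abs_le]
  constructor <;> linarith [neg_abs_le (Real.log x), abs_nonneg (Real.log x)]

theorem log_max_le_log_add_rpow_div {x y s : ℝ} (hx : 0 < x) (hy : 0 ≤ y) (hs : 0 < s) :
    Real.log (max x y) ≤ Real.log x + (y / x) ^ s / s := by
  rcases le_total y x with hyx | hxy
  · rw [max_eq_left hyx]
    exact le_add_of_nonneg_right (by positivity)
  · have hy₀ := hx.trans_le hxy
    rw [max_eq_right hxy, ← sub_le_iff_le_add', ← Real.log_div hy₀.ne' hx.ne']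
    exact Real.log_le_rpow_div (by positivity) hs

theorem integrable_log_of_integrable_rpow_neg {V : Type*} [MeasurableSpace V] {σ : Measure V}
    {f : V → ℝ} {s : ℝ} (hs : 0 < s) (hfm : Measurable f) (hf : Integrable f σ)
    (hf₀ : ∀ᵐ v ∂σ, 0 < f v) (hfs : Integrable (fun v => f v ^ (-s)) σ) :
    Integrable (fun v => Real.log (f v)) σ := by
  refine (hf.add (hfs.div_const s)).mono' (Real.measurable_log.comp hfm).aestronglyMeasurable ?_
  filter_upwards [hf₀] with v hv
  have hneg : -Real.log (f v) ≤ f v ^ (-s) / s := by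
    rw [← Real.log_inv, Real.rpow_neg hv.le, ← Real.inv_rpow hv.le]
    exact Real.log_le_rpow_div (inv_nonneg.2 hv.le) hs
  rw [Real.norm_eq_abs, Pi.add_apply, abs_le]
  constructor <;>
    linarith [Real.log_le_self hv.le, div_nonneg (Real.rpow_nonneg hv.le (-s)) hs.le]

theorem nonpos_of_forall_log_add_mul_le {A m D s : ℝ} (hA : 0 < A) (hs : 1 < s)
    (h : ∀ ε > 0, Real.log (A + ε * m) - Real.log A ≤ D * ε ^ s) : m ≤ 0 := by
  have hderiv : HasDerivAt (fun ε : ℝ => Real.log (A + ε * m)) (m / A) 0 := by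
    have : HasDerivAt (fun ε : ℝ => A + ε * m) m 0 := by
      simpa using ((hasDerivAt_id (0 : ℝ)).mul_const m).const_add A
    simpa using this.log (by simpa using hA.ne')
  have hslope := hderiv.tendsto_slope_zero_right
  have hzero : Tendsto (fun ε : ℝ => D * ε ^ (s - 1)) (𝓝[>] 0) (𝓝 0) := by
    have : ContinuousAt (fun ε : ℝ => D * ε ^ (s - 1)) 0 :=
      continuousAt_const.mul (Real.continuousAt_rpow_const 0 (s - 1) (.inr (by linarith)))
    simpa [ContinuousAt, Real.zero_rpow (by linarith : s - 1 ≠ 0)] using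
      this.tendsto.mono_left nhdsWithin_le_nhds
  have hle : m / A ≤ 0 := by
    refine le_of_tendsto_of_tendsto hslope hzero ?_
    filter_upwards [self_mem_nhdsWithin] with ε hε
    have hε' : (0 : ℝ) < ε := hε
    rw [zero_add, zero_mul, add_zero, smul_eq_mul, inv_mul_le_iff₀ hε']
    refine (h ε hε').trans_eq ?_
    rw [Real.rpow_sub_one hε'.ne']
    field_simp
  simpa [div_nonpos_iff, hA.le, hA.not_ge] using hle

section WeightedSup

variable {V ι : Type*}

/-- The upper envelope of the functions `w i`, scaled by weights `a i`. -/
def weightedSup (w : ι → V → ℝ) (a : ι → ℝ) (v : V) : ℝ :=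
  ⨆ i, a i * w i v

theorem weightedSup_smul (w : ι → V → ℝ) {c : ℝ} (hc : 0 ≤ c) (a : ι → ℝ) (v : V) :
    weightedSup w (c • a) v = c * weightedSup w a v := by
  simp only [weightedSup, Real.mul_iSup_of_nonneg hc, Pi.smul_apply, smul_eq_mul, mul_assoc]

theorem dominanceCell_smul (w : ι → V → ℝ) (a : ι → ℝ) {c : ℝ} (hc : 0 < c) (i : ι) :
    dominanceCell (fun i v => (c • a) i * w i v) i = dominanceCell (fun i v => a i * w i v) i := by
  simp only [dominanceCell, Pi.smul_apply, smul_eq_mul, mul_assoc, mul_lt_mul_iff_right₀ hc]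

theorem weightedSup_add_single [DecidableEq ι] (w : ι → V → ℝ) (a : ι → ℝ) (i : ι) (t c : ℝ)
    (v : V) :
    weightedSup w (a + Pi.single i (t * c)) v =
      ⨆ j, (a j * w j v + t * ((Pi.single i c : ι → ℝ) j * w j v)) := by
  refine iSup_congr fun j => ?_
  by_cases hj : j = i
  · subst hj
    simp only [Pi.add_apply, Pi.single_eq_same]
    ring
  · simp [hj]

theorem mul_pos_of_mem_dominanceCell {w : ι → V → ℝ} (hex : ∀ v, ∃ i, 0 < w i v) {a : ι → ℝ}
    (ha : ∀ i, 0 < a i) {k : ι} {v : V} (hk : v ∈ dominanceCell (fun i v => a i * w i v) k) :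
    0 < a k * w k v := by
  obtain ⟨j, hj⟩ := hex v
  have hajv := mul_pos (ha j) hj
  by_cases hjk : j = k
  · exact hjk ▸ hajv
  · exact hajv.trans (hk j hjk)

variable [Finite ι] {w : ι → V → ℝ}

theorem le_weightedSup (w : ι → V → ℝ) (a : ι → ℝ) (v : V) (i : ι) :
    a i * w i v ≤ weightedSup w a v :=
  le_ciSup (finite_range fun i => a i * w i v).bddAbove i

theorem weightedSup_mono [Nonempty ι] (hw : ∀ i v, 0 ≤ w i v) {a b : ι → ℝ} (hab : a ≤ b) (v : V) :
    weightedSup w a v ≤ weightedSup w b v :=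
  ciSup_le fun i => (mul_le_mul_of_nonneg_right (hab i) (hw i v)).trans (le_weightedSup w b v i)

theorem weightedSup_update_le [Nonempty ι] [DecidableEq ι] (w : ι → V → ℝ) (a : ι → ℝ) (i : ι)
    (ε : ℝ) (v : V) :
    weightedSup w (Function.update a i ε) v ≤ max (weightedSup w a v) (ε * w i v) := by
  refine ciSup_le fun j => ?_
  by_cases hj : j = i
  · subst hj
    simp
  · rw [Function.update_of_ne hj]
    exact (le_weightedSup w a v j).trans (le_max_left _ _)

theorem log_weightedSup_update_le [DecidableEq ι] (hw₀ : ∀ i v, 0 ≤ w i v) {a : ι → ℝ} {i j : ι}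
    (hij : j ≠ i) (haj : 0 < a j) {v : V} (hv : 0 < w j v) {B ε s : ℝ} (hB : w i v ≤ B)
    (hε : 0 < ε) (hs : 0 < s) :
    Real.log (weightedSup w (Function.update a i ε) v) ≤
      Real.log (weightedSup w a v) + ε ^ s * ((B / a j) ^ s / s) * w j v ^ (-s) := by
  have : Nonempty ι := ⟨i⟩
  have hajv : 0 < a j * w j v := mul_pos haj hv
  have hle : a j * w j v ≤ weightedSup w a v := le_weightedSup w a v j
  have hle' : a j * w j v ≤ weightedSup w (Function.update a i ε) v := by
    simpa [hij] using le_weightedSup w (Function.update a i ε) v j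
  have hnum : 0 ≤ ε * w i v := mul_nonneg hε.le (hw₀ i v)
  have hden : 0 < weightedSup w a v := hajv.trans_le hle
  have hB₀ : 0 ≤ B := (hw₀ i v).trans hB
  calc Real.log (weightedSup w (Function.update a i ε) v)
      ≤ Real.log (max (weightedSup w a v) (ε * w i v)) :=
        Real.log_le_log (hajv.trans_le hle') (weightedSup_update_le w a i ε v)
    _ ≤ Real.log (weightedSup w a v) + (ε * w i v / weightedSup w a v) ^ s / s :=
        log_max_le_log_add_rpow_div hden hnum hs
    _ ≤ Real.log (weightedSup w a v) + (ε * B / (a j * w j v)) ^ s / s := by gcongr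
    _ = Real.log (weightedSup w a v) + ε ^ s * ((B / a j) ^ s / s) * w j v ^ (-s) := by
        rw [show ε * B / (a j * w j v) = ε * (B / a j) * (w j v)⁻¹ by field_simp,
          Real.mul_rpow (by positivity) (by positivity), Real.mul_rpow hε.le (by positivity),
          Real.inv_rpow hv.le, ← Real.rpow_neg hv.le]
        ring

theorem continuous_weightedSup [TopologicalSpace V] (hw : ∀ i, Continuous (w i)) :
    Continuous fun z : (ι → ℝ) × V => weightedSup w z.1 z.2 := by
  let : TopologicalSpace ι := ⊥
  have : DiscreteTopology ι := ⟨rfl⟩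
  refine continuous_iSup_of_compact (f := fun (z : (ι → ℝ) × V) i => z.1 i * w i z.2) ?_
  exact continuous_prod_of_discrete_right.2 fun i =>
    ((continuous_apply i).comp continuous_fst).mul ((hw i).comp continuous_snd)

end WeightedSup

section LogEnergy

variable {V ι : Type*} [TopologicalSpace V] [CompactSpace V] [MeasurableSpace V] [BorelSpace V]
  {σ : Measure V} [IsFiniteMeasure σ] {w : ι → V → ℝ} {m a : ι → ℝ}

/-- The logarithmic energy of the upper envelope of `a i * w i`. When `w i v = |⟪e i, v⟫| ^ q`, it
is `-q` times the entropy of the symmetric polytope with vertices `± a i ^ (1 / q) • e i`. -/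
def logEnergy (σ : Measure V) (w : ι → V → ℝ) (a : ι → ℝ) : ℝ :=
  ∫ v, Real.log (weightedSup w a v) ∂σ

section

variable [Finite ι]

theorem integrable_log_weightedSup (hw : ∀ i, Continuous (w i)) {j : ι} (ha : 0 < a j)
    (hpos : ∀ᵐ v ∂σ, 0 < w j v) (hlog : Integrable (fun v => Real.log (w j v)) σ) :
    Integrable (fun v => Real.log (weightedSup w a v)) σ := by
  have hcont : Continuous (weightedSup w a) := (continuous_weightedSup hw).comp (.prodMk_right a)
  refine ((hcont.integrable_of_hasCompactSupport (.of_compactSpace _)).add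
    ((integrable_const |Real.log (a j)|).add hlog.abs)).mono'
    (Real.measurable_log.comp hcont.measurable).aestronglyMeasurable ?_
  filter_upwards [hpos] with v hv
  refine (abs_log_le_add_abs_log (mul_pos ha hv) (le_weightedSup w a v j)).trans ?_
  rw [Real.log_mul ha.ne' hv.ne']
  exact add_le_add_right (abs_add_le _ _) _

theorem logEnergy_smul (hw : ∀ i, Continuous (w i)) {j : ι} (ha : 0 < a j)
    (hpos : ∀ᵐ v ∂σ, 0 < w j v) (hlog : Integrable (fun v => Real.log (w j v)) σ)
    {c : ℝ} (hc : 0 < c) :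
    logEnergy σ w (c • a) = σ.real univ * Real.log c + logEnergy σ w a := by
  have hsplit : ∀ᵐ v ∂σ, Real.log (weightedSup w (c • a) v) =
      Real.log c + Real.log (weightedSup w a v) := by
    filter_upwards [hpos] with v hv
    rw [weightedSup_smul w hc.le,
      Real.log_mul hc.ne' ((mul_pos ha hv).trans_le (le_weightedSup w a v j)).ne']
  rw [logEnergy, integral_congr_ae hsplit, integral_add (integrable_const _)
    (integrable_log_weightedSup hw ha hpos hlog), integral_const, smul_eq_mul, logEnergy]

theorem exists_forall_logEnergy_update_le [DecidableEq ι] (hw : ∀ i, Continuous (w i))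
    (hw₀ : ∀ i v, 0 ≤ w i v) {s : ℝ} (hs : 0 < s) {j : ι} (haj : 0 < a j)
    (hpos : ∀ᵐ v ∂σ, 0 < w j v) (hint : Integrable (fun v => w j v ^ (-s)) σ)
    {i : ι} (hij : j ≠ i) :
    ∃ D, ∀ ε > 0, logEnergy σ w (Function.update a i ε) ≤ logEnergy σ w a + D * ε ^ s := by
  have hlog : Integrable (fun v => Real.log (w j v)) σ :=
    integrable_log_of_integrable_rpow_neg hs (hw j).measurable
      ((hw j).integrable_of_hasCompactSupport (.of_compactSpace _)) hpos hint
  obtain ⟨B, -, hwB⟩ := exists_forall_abs_le_of_continuous (hw i)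
  set d : ℝ := (B / a j) ^ s / s
  refine ⟨d * ∫ v, w j v ^ (-s) ∂σ, fun ε hε => ?_⟩
  have hint_a := integrable_log_weightedSup hw haj hpos hlog
  have hint_update := integrable_log_weightedSup (a := Function.update a i ε) hw
    (by rwa [Function.update_of_ne hij]) hpos hlog
  calc logEnergy σ w (Function.update a i ε)
      ≤ ∫ v, (Real.log (weightedSup w a v) + ε ^ s * d * w j v ^ (-s)) ∂σ :=
        integral_mono_ae hint_update (hint_a.add (hint.const_mul _))
          (hpos.mono fun v hv =>
            log_weightedSup_update_le hw₀ hij haj hv ((le_abs_self _).trans (hwB v)) hε hs)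
    _ = logEnergy σ w a + d * (∫ v, w j v ^ (-s) ∂σ) * ε ^ s := by
        rw [integral_add hint_a (hint.const_mul _), integral_const_mul, logEnergy]
        ring

theorem hasDerivAt_logEnergy_add_single [Nonempty ι] [DecidableEq ι]
    (hw : ∀ i, Continuous (w i)) (hex : ∀ v, ∃ i, 0 < w i v) (ha : ∀ i, 0 < a i)
    (htie : ∀ i j, i ≠ j → ∀ᵐ v ∂σ, a i * w i v ≠ a j * w j v) (i : ι) :
    HasDerivAt (fun t : ℝ => logEnergy σ w (a + Pi.single i (t * a i)))
      (σ.real (dominanceCell (fun i v => a i * w i v) i)) 0 := by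
  cases nonempty_fintype ι
  let _ : TopologicalSpace ι := ⊥
  have : DiscreteTopology ι := ⟨rfl⟩
  have hcont (b : ι → ℝ) : Continuous fun z : V × ι => b z.2 * w z.2 z.1 :=
    continuous_prod_of_discrete_right.2 fun i => (hw i).const_mul (b i)
  obtain ⟨k, hk⟩ := exists_ae_mem_dominanceCell htie
  have hquot : ∀ᵐ v ∂σ, (Pi.single i (a i) : ι → ℝ) (k v) * w (k v) v / (a (k v) * w (k v) v) =
      (Pi.single i 1 : ι → ℝ) (k v) := by
    filter_upwards [hk] with v hv
    have hdom := (mul_pos_of_mem_dominanceCell hex ha hv).ne'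
    by_cases hki : k v = i
    · rw [hki] at hdom ⊢
      simp only [Pi.single_eq_same, div_self hdom]
    · simp [hki]
  have henvelope := hasDerivAt_integral_log_iSup_add_mul (hcont a)
    (h := fun v j => (Pi.single i (a i) : ι → ℝ) j * w j v) (hcont (Pi.single i (a i)))
    (fun v => (hex v).imp fun j hj => mul_pos (ha j) hj) hk
  rw [integral_congr_ae hquot, integral_comp_dominanceCell_index (fun j =>
    (isOpen_dominanceCell (fun i => (hw i).const_mul (a i)) j).measurableSet) hk] at henvelope
  simpa only [logEnergy, weightedSup_add_single, Pi.single_apply, mul_ite, mul_one, mul_zero,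
    Finset.sum_ite_eq', Finset.mem_univ, if_true] using henvelope

end

/-- The normalised weights: nonnegative, with largest entry `1`. -/
def unitWeights (ι : Type*) [Fintype ι] : Set (ι → ℝ) :=
  {a | 0 ≤ a ∧ ‖a‖ = 1}

section

variable [Fintype ι]

theorem isCompact_unitWeights : IsCompact (unitWeights ι) := by
  have : unitWeights ι = Metric.sphere 0 1 ∩ Ici 0 := by
    ext a
    simp [unitWeights, and_comm]
  rw [this]
  exact (isCompact_sphere 0 1).inter_right isClosed_Ici

theorem exists_eq_one_of_mem_unitWeights [Nonempty ι] (ha : a ∈ unitWeights ι) : ∃ j, a j = 1 := by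
  obtain ⟨j, hj⟩ := Finite.exists_max fun i => ‖a i‖
  refine ⟨j, ?_⟩
  rw [← abs_of_nonneg (ha.1 j), ← Real.norm_eq_abs, ← ha.2]
  exact le_antisymm (norm_le_pi_norm a j) ((pi_norm_le_iff_of_nonempty a).2 hj)

theorem exists_mem_unitWeights_eq_smul (ha : 0 ≤ a) (ha₀ : a ≠ 0) :
    ∃ b ∈ unitWeights ι, a = ‖a‖ • b := by
  have hnorm : ‖a‖ ≠ 0 := norm_ne_zero_iff.2 ha₀
  refine ⟨‖a‖⁻¹ • a, ⟨smul_nonneg (inv_nonneg.2 (norm_nonneg a)) ha, ?_⟩, ?_⟩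
  · rw [norm_smul, norm_inv, norm_norm, inv_mul_cancel₀ hnorm]
  · rw [smul_inv_smul₀ hnorm]

theorem continuousOn_logEnergy [Nonempty ι] (hw : ∀ i, Continuous (w i)) (hw₀ : ∀ i v, 0 ≤ w i v)
    (hpos : ∀ i, ∀ᵐ v ∂σ, 0 < w i v) (hlog : ∀ i, Integrable (fun v => Real.log (w i v)) σ) :
    ContinuousOn (logEnergy σ w) (unitWeights ι) := by
  have hcont := continuous_weightedSup hw
  have hmeas (a : ι → ℝ) : Measurable (weightedSup w a) :=
    (hcont.comp (.prodMk_right a)).measurable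
  have hpos' := ae_all_iff.2 hpos
  refine continuousOn_of_dominated
    (bound := fun v => weightedSup w 1 v + ∑ j, |Real.log (w j v)|)
    (fun a _ => (Real.measurable_log.comp (hmeas a)).aestronglyMeasurable) (fun a ha => ?_)
    (((hcont.comp (.prodMk_right 1)).integrable_of_hasCompactSupport (.of_compactSpace _)).add
      (integrable_finsetSum _ fun j _ => (hlog j).abs)) ?_
  · obtain ⟨j, hj⟩ := exists_eq_one_of_mem_unitWeights ha
    have hle_one : a ≤ 1 := fun i =>
      (le_abs_self _).trans ((norm_le_pi_norm a i).trans ha.2.le)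
    filter_upwards [hpos'] with v hv
    have hwj : w j v ≤ weightedSup w a v := by simpa [hj] using le_weightedSup w a v j
    exact (abs_log_le_add_abs_log (hv j) hwj).trans (add_le_add (weightedSup_mono hw₀ hle_one v)
      (Finset.single_le_sum (f := fun j => |Real.log (w j v)|) (fun _ _ => abs_nonneg _)
        (Finset.mem_univ j)))
  · filter_upwards [hpos'] with v hv
    refine ContinuousOn.log (hcont.comp (.prodMk_left v)).continuousOn fun a ha => ?_
    obtain ⟨j, hj⟩ := exists_eq_one_of_mem_unitWeights ha
    have hwj : w j v ≤ weightedSup w a v := by simpa [hj] using le_weightedSup w a v j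
    exact ((hv j).trans_le hwj).ne'

/-- The scale-invariant functional whose positive minimisers solve the discrete problem with
masses `m`: the logarithmic energy, normalised by the total mass `∑ i, m i * a i`. -/
def reducedEnergy (σ : Measure V) (w : ι → V → ℝ) (m a : ι → ℝ) : ℝ :=
  logEnergy σ w a - σ.real univ * Real.log (∑ i, m i * a i)

theorem sum_mul_pos (hm : ∀ i, 0 < m i) (ha : 0 ≤ a) {j : ι} (haj : 0 < a j) :
    0 < ∑ i, m i * a i :=
  Finset.sum_pos' (fun i _ => mul_nonneg (hm i).le (ha i))
    ⟨j, Finset.mem_univ j, mul_pos (hm j) haj⟩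

theorem sum_mul_add_single [DecidableEq ι] (m a : ι → ℝ) (i : ι) (c : ℝ) :
    ∑ j, m j * (a + Pi.single i c : ι → ℝ) j = ∑ j, m j * a j + m i * c := by
  simp [mul_add, Finset.sum_add_distrib, Pi.single_apply]

theorem reducedEnergy_smul (hw : ∀ i, Continuous (w i)) (hm : ∀ i, 0 < m i) (ha : 0 ≤ a) {j : ι}
    (haj : 0 < a j) (hpos : ∀ᵐ v ∂σ, 0 < w j v)
    (hlog : Integrable (fun v => Real.log (w j v)) σ) {c : ℝ} (hc : 0 < c) :
    reducedEnergy σ w m (c • a) = reducedEnergy σ w m a := by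
  have hsum : ∑ i, m i * (c • a) i = c * ∑ i, m i * a i := by
    simp only [Finset.mul_sum, Pi.smul_apply, smul_eq_mul, mul_left_comm]
  rw [reducedEnergy, reducedEnergy, hsum, Real.log_mul hc.ne' (sum_mul_pos hm ha haj).ne',
    logEnergy_smul hw haj hpos hlog hc]
  ring

theorem exists_forall_reducedEnergy_le [Nonempty ι] (hw : ∀ i, Continuous (w i))
    (hw₀ : ∀ i v, 0 ≤ w i v) (hpos : ∀ i, ∀ᵐ v ∂σ, 0 < w i v)
    (hlog : ∀ i, Integrable (fun v => Real.log (w i v)) σ) (hm : ∀ i, 0 < m i) :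
    ∃ a ∈ unitWeights ι, ∀ b, 0 ≤ b → b ≠ 0 → reducedEnergy σ w m a ≤ reducedEnergy σ w m b := by
  have hcont : ContinuousOn (reducedEnergy σ w m) (unitWeights ι) := by
    refine (continuousOn_logEnergy hw hw₀ hpos hlog).sub
      (continuousOn_const.mul (ContinuousOn.log (by fun_prop) fun a ha => ?_))
    obtain ⟨j, hj⟩ := exists_eq_one_of_mem_unitWeights ha
    exact (sum_mul_pos hm ha.1 (hj ▸ one_pos)).ne'
  obtain ⟨a, ha, hmin⟩ := isCompact_unitWeights.exists_isMinOn
    ⟨1, zero_le_one, norm_one⟩ hcont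
  refine ⟨a, ha, fun b hb hb₀ => ?_⟩
  obtain ⟨u, hu, hbu⟩ := exists_mem_unitWeights_eq_smul hb hb₀
  obtain ⟨j, hj⟩ := exists_eq_one_of_mem_unitWeights hu
  rw [hbu, reducedEnergy_smul hw hm hu.1 (hj ▸ one_pos) (hpos j) (hlog j) (norm_pos_iff.2 hb₀)]
  exact hmin hu

theorem pos_of_forall_reducedEnergy_le [NeZero σ] (hw : ∀ i, Continuous (w i))
    (hw₀ : ∀ i v, 0 ≤ w i v) (hpos : ∀ i, ∀ᵐ v ∂σ, 0 < w i v) {s : ℝ} (hs : 1 < s)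
    (hint : ∀ i, Integrable (fun v => w i v ^ (-s)) σ) (hm : ∀ i, 0 < m i) (ha : 0 ≤ a)
    (ha₀ : a ≠ 0) (hmin : ∀ b, 0 ≤ b → b ≠ 0 → reducedEnergy σ w m a ≤ reducedEnergy σ w m b)
    (i : ι) : 0 < a i := by
  classical
  by_contra hi
  have hi₀ : a i = 0 := (not_lt.1 hi).antisymm (ha i)
  obtain ⟨j, hj⟩ := Function.ne_iff.1 ha₀
  have haj : 0 < a j := (ha j).lt_of_ne' hj
  have hji : j ≠ i := by
    rintro rfl
    exact hi haj
  obtain ⟨D, hD⟩ := exists_forall_logEnergy_update_le hw hw₀ (zero_lt_one.trans hs) haj (hpos j)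
    (hint j) hji
  have hσ : 0 < σ.real univ := measureReal_univ_pos
  refine (hm i).not_ge (nonpos_of_forall_log_add_mul_le (sum_mul_pos hm ha haj) hs
    (D := D / σ.real univ) fun ε hε => ?_)
  have hsum : ∑ k, m k * Function.update a i ε k = ∑ k, m k * a k + ε * m i := by
    have hupdate : Function.update a i ε = a + Pi.single i ε := by
      ext k
      by_cases hk : k = i
      · subst hk
        simp [hi₀]
      · simp [hk]
    rw [hupdate, sum_mul_add_single, mul_comm ε]
  have hle := hmin (Function.update a i ε) (le_update_iff.2 ⟨hε.le, fun k _ => ha k⟩)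
    (Function.ne_iff.2 ⟨i, by simp [hε.ne']⟩)
  rw [reducedEnergy, reducedEnergy, hsum] at hle
  rw [div_mul_eq_mul_div, le_div_iff₀ hσ]
  linarith [hD ε hε]

/-- The Euler–Lagrange equation of the reduced energy at a minimiser with positive entries. -/
theorem measureReal_dominanceCell_mul_sum (hw : ∀ i, Continuous (w i))
    (hex : ∀ v, ∃ i, 0 < w i v) (hm : ∀ i, 0 < m i) (ha : ∀ i, 0 < a i)
    (htie : ∀ i j, i ≠ j → ∀ᵐ v ∂σ, a i * w i v ≠ a j * w j v)
    (hmin : ∀ b, (∀ i, 0 < b i) → reducedEnergy σ w m a ≤ reducedEnergy σ w m b) (i : ι) :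
    σ.real (dominanceCell (fun i v => a i * w i v) i) * ∑ j, m j * a j =
      σ.real univ * (m i * a i) := by
  classical
  have : Nonempty ι := ⟨i⟩
  have hsum := sum_mul_pos hm (fun j => (ha j).le) (ha i)
  have hmass : HasDerivAt (fun t : ℝ => σ.real univ *
      Real.log (∑ j, m j * (a + Pi.single i (t * a i) : ι → ℝ) j))
      (σ.real univ * (m i * a i / ∑ j, m j * a j)) 0 := by
    simp only [sum_mul_add_single]
    have hlinear : HasDerivAt (fun t : ℝ => ∑ j, m j * a j + m i * (t * a i)) (m i * a i) 0 := by
      simpa using (((hasDerivAt_id (0 : ℝ)).mul_const (a i)).const_mul (m i)).const_add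
        (∑ j, m j * a j)
    simpa using (hlinear.log (by simpa using hsum.ne')).const_mul (σ.real univ)
  have hlocal : IsLocalMin (fun t : ℝ => reducedEnergy σ w m (a + Pi.single i (t * a i))) 0 := by
    filter_upwards [Ioi_mem_nhds (neg_one_lt_zero : (-1 : ℝ) < 0)] with t ht
    have ht' : 0 < 1 + t := by linarith [mem_Ioi.1 ht]
    simp only [zero_mul, Pi.single_zero, add_zero]
    refine hmin _ fun j => ?_
    by_cases hj : j = i
    · subst hj
      simpa [← one_add_mul] using mul_pos ht' (ha j)
    · simpa [hj] using ha j
  have hzero := hlocal.hasDerivAt_eq_zero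
    ((hasDerivAt_logEnergy_add_single hw hex ha htie i).sub hmass)
  rwa [sub_eq_zero, mul_div_assoc', eq_div_iff hsum.ne'] at hzero

end

/-- The weights minimise the reduced energy, up to scaling. The integrability exponent `s > 1` keeps
the minimiser away from the boundary. -/
theorem exists_pos_measureReal_dominanceCell_eq [NeZero σ] [Finite ι] [Nonempty ι]
    (hw : ∀ i, Continuous (w i)) (hw₀ : ∀ i v, 0 ≤ w i v) (hex : ∀ v, ∃ i, 0 < w i v)
    (hpos : ∀ i, ∀ᵐ v ∂σ, 0 < w i v) {s : ℝ} (hs : 1 < s)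
    (hint : ∀ i, Integrable (fun v => w i v ^ (-s)) σ)
    (htie : ∀ a : ι → ℝ, (∀ i, 0 < a i) → ∀ i j, i ≠ j → ∀ᵐ v ∂σ, a i * w i v ≠ a j * w j v)
    (hm : ∀ i, 0 < m i) :
    ∃ a : ι → ℝ, (∀ i, 0 < a i) ∧
      ∀ i, σ.real (dominanceCell (fun i v => a i * w i v) i) = m i * a i := by
  cases nonempty_fintype ι
  have hlog (i : ι) : Integrable (fun v => Real.log (w i v)) σ :=
    integrable_log_of_integrable_rpow_neg (zero_lt_one.trans hs) (hw i).measurable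
      ((hw i).integrable_of_hasCompactSupport (.of_compactSpace _)) (hpos i) (hint i)
  obtain ⟨a, ha_unit, hmin⟩ := exists_forall_reducedEnergy_le hw hw₀ hpos hlog hm
  have ha₀ : a ≠ 0 := norm_ne_zero_iff.1 (ha_unit.2.trans_ne one_ne_zero)
  have ha := pos_of_forall_reducedEnergy_le hw hw₀ hpos hs hint hm ha_unit.1 ha₀ hmin
  have hEL := measureReal_dominanceCell_mul_sum hw hex hm ha (htie a ha) fun b hb =>
    hmin b (fun i => (hb i).le) (Function.ne_iff.2 ⟨Classical.arbitrary ι, (hb _).ne'⟩)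
  have hsum := sum_mul_pos hm ha_unit.1 (ha (Classical.arbitrary ι))
  have hc : 0 < σ.real univ / ∑ j, m j * a j := div_pos measureReal_univ_pos hsum
  refine ⟨(σ.real univ / ∑ j, m j * a j) • a, fun i => mul_pos hc (ha i), fun i => ?_⟩
  rw [dominanceCell_smul w a hc, eq_div_of_mul_eq hsum.ne' (hEL i), Pi.smul_apply, smul_eq_mul]
  ring

end LogEnergy

theorem integrable_rpow_neg_of_measure_lt_le {α : Type*} [MeasurableSpace α] {μ : Measure α}
    [IsFiniteMeasure μ] {f : α → ℝ} (hfm : Measurable f) (hf : ∀ x, 0 ≤ f x) {C : ℝ≥0∞}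
    (hC : C ≠ ∞) (hsub : ∀ ε, 0 < ε → ε ≤ 1 → μ {x | f x < ε} ≤ C * ENNReal.ofReal ε) {r : ℝ}
    (hr : 0 < r) (hr₁ : r < 1) : Integrable (fun x => f x ^ (-r)) μ := by
  have hmeas : Measurable fun x => f x ^ (-r) := hfm.pow_const _
  have hnonneg (x : α) : 0 ≤ f x ^ (-r) := Real.rpow_nonneg (hf x) _
  have htail : ∀ t ∈ Ioi (1 : ℝ), μ {x | t < f x ^ (-r)} ≤ C * ENNReal.ofReal (t ^ (-r⁻¹)) := by
    intro t ht
    have ht₀ : (0 : ℝ) < t := zero_lt_one.trans ht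
    refine (measure_mono fun x hx => (?_ : f x < t ^ (-r⁻¹))).trans
      (hsub _ (Real.rpow_pos_of_pos ht₀ _)
        (Real.rpow_le_one_of_one_le_of_nonpos (le_of_lt ht) (by simp [hr.le])))
    have hx : t < f x ^ (-r) := hx
    have hfx : 0 < f x := by
      refine (hf x).lt_of_ne' fun h => ?_
      rw [h, Real.zero_rpow (neg_ne_zero.2 hr.ne')] at hx
      exact hx.not_gt ht₀
    have := Real.rpow_lt_rpow_of_neg ht₀ hx (neg_neg_iff_pos.2 (inv_pos.2 hr))
    rwa [← Real.rpow_mul hfx.le, neg_mul_neg, mul_inv_cancel₀ hr.ne', Real.rpow_one] at this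
  refine ⟨hmeas.aestronglyMeasurable, ?_⟩
  rw [hasFiniteIntegral_iff_ofReal (ae_of_all _ hnonneg),
    lintegral_eq_lintegral_meas_lt _ (ae_of_all _ hnonneg) hmeas.aemeasurable,
    ← Ioc_union_Ioi_eq_Ioi (zero_le_one' ℝ)]
  refine (lintegral_union_le _ _ _).trans_lt (ENNReal.add_lt_top.2 ⟨?_, ?_⟩)
  · refine (setLIntegral_mono measurable_const fun t _ => measure_mono (subset_univ _)).trans_lt ?_
    simp only [lintegral_const, Measure.restrict_apply_univ, Real.volume_Ioc]
    exact ENNReal.mul_lt_top (measure_lt_top _ _) ENNReal.ofReal_lt_top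
  · refine (setLIntegral_mono (by fun_prop) htail).trans_lt ?_
    rw [lintegral_const_mul _ (by fun_prop)]
    have hint : IntegrableOn (fun t : ℝ => t ^ (-r⁻¹)) (Ioi 1) :=
      integrableOn_Ioi_rpow_of_lt (neg_lt_neg (one_lt_inv_iff₀.2 ⟨hr, hr₁⟩)) one_pos
    exact ENNReal.mul_lt_top hC.lt_top hint.lintegral_lt_top

section SphereMeasure

variable {F : Type*} [NormedAddCommGroup F] [MeasurableSpace F] [BorelSpace F]

theorem measurePreserving_neg_toSphere [NormedSpace ℝ F] (ν : Measure F) [ν.IsNegInvariant] :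
    MeasurePreserving (fun v : Metric.sphere (0 : F) 1 => -v) ν.toSphere ν.toSphere := by
  have hneg : Measurable fun v : Metric.sphere (0 : F) 1 => -v := continuous_neg.measurable
  refine ⟨hneg, Measure.ext fun s hs => ?_⟩
  rw [Measure.map_apply hneg hs, Measure.toSphere_apply' _ hs, Measure.toSphere_apply' _ (hneg hs)]
  congr 1
  refine (congrArg ν (ext fun x => ?_)).trans (Measure.measure_neg ν _)
  constructor
  · rintro ⟨r, hr, _, ⟨v, hv, rfl⟩, hx⟩
    have hx : r • (v : F) = x := hx
    exact ⟨r, hr, _, ⟨-v, hv, rfl⟩, by simp [hx]⟩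
  · rintro ⟨r, hr, _, ⟨v, hv, rfl⟩, hx⟩
    have hx : r • (v : F) = -x := hx
    exact ⟨r, hr, _, ⟨-v, by simpa using hv, rfl⟩, by simp [hx]⟩

variable [InnerProductSpace ℝ F] [FiniteDimensional ℝ F] (ν : Measure F) [ν.IsAddHaarMeasure]

theorem ae_toSphere_inner_ne_zero {w : F} (hw : w ≠ 0) :
    ∀ᵐ v : Metric.sphere (0 : F) 1 ∂ν.toSphere, inner ℝ w (v : F) ≠ 0 := by
  have hmeas : MeasurableSet {v : Metric.sphere (0 : F) 1 | inner ℝ w (v : F) = 0} :=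
    (isClosed_eq (by fun_prop) continuous_const).measurableSet
  have hker : LinearMap.ker (innerₗ F w) ≠ ⊤ := fun h =>
    hw (by simpa using h.ge (Submodule.mem_top (x := w)))
  rw [ae_iff]
  simp only [ne_eq, not_not]
  rw [Measure.toSphere_apply' _ hmeas]
  refine mul_eq_zero_of_right _ (measure_mono_null ?_ (Measure.addHaar_submodule ν _ hker))
  rintro _ ⟨r, -, _, ⟨v, hv, rfl⟩, rfl⟩
  have hv : inner ℝ w (v : F) = 0 := hv
  simp [hv]

/-- The slab lies in the image of a ball of radius `2` under the transvection that contracts the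
direction `u` by the factor `ε`. -/
theorem addHaar_slab_le {u : F} (hu : ‖u‖ = 1) {ε : ℝ} (hε : 0 < ε) (hε₁ : ε ≤ 1) :
    ν {x : F | ‖x‖ ≤ 1 ∧ |inner ℝ u x| < ε} ≤
      ENNReal.ofReal ε * ν (Metric.closedBall (0 : F) 2) := by
  let L : F →ₗ[ℝ] F := LinearMap.transvection (innerₗ F u) ((ε - 1) • u)
  have huu : inner ℝ u u = (1 : ℝ) := by rw [real_inner_self_eq_norm_sq, hu, one_pow]
  have hdet : LinearMap.det L = ε := by
    rw [LinearMap.transvection.det]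
    simp [hu]
  have himage := Measure.addHaar_image_linearMap ν L (Metric.closedBall 0 2)
  rw [hdet, abs_of_pos hε] at himage
  rw [← himage]
  refine measure_mono ?_
  rintro x ⟨hx, hxu⟩
  refine ⟨x + ((ε⁻¹ - 1) * inner ℝ u x) • u, ?_, ?_⟩
  · have hε_inv : 0 ≤ ε⁻¹ - 1 := sub_nonneg.2 ((one_le_inv₀ hε).2 hε₁)
    have hshift : (ε⁻¹ - 1) * |inner ℝ u x| ≤ 1 - ε :=
      calc (ε⁻¹ - 1) * |inner ℝ u x| ≤ (ε⁻¹ - 1) * ε := by gcongr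
        _ = 1 - ε := by field_simp
    rw [mem_closedBall_zero_iff]
    refine (norm_add_le _ _).trans ?_
    rw [norm_smul, hu, mul_one, Real.norm_eq_abs, abs_mul, abs_of_nonneg hε_inv]
    linarith
  · have hcancel : (ε⁻¹ - 1) * inner ℝ u x +
        (inner ℝ u x + (ε⁻¹ - 1) * inner ℝ u x * 1) * (ε - 1) = 0 := by
      field_simp
      ring
    simp only [L, LinearMap.transvection.apply, innerₗ_apply_apply, inner_add_right,
      inner_smul_right, huu, smul_smul]
    rw [add_assoc, ← add_smul, hcancel, zero_smul, add_zero]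

theorem toSphere_slab_le (u : Metric.sphere (0 : F) 1) {ε : ℝ} (hε : 0 < ε) (hε₁ : ε ≤ 1) :
    ν.toSphere {v | |inner ℝ (u : F) (v : F)| < ε} ≤
      Module.finrank ℝ F * ν (Metric.closedBall (0 : F) 2) * ENNReal.ofReal ε := by
  have hmeas : MeasurableSet {v : Metric.sphere (0 : F) 1 | |inner ℝ (u : F) (v : F)| < ε} :=
    (isOpen_lt (by fun_prop) continuous_const).measurableSet
  rw [Measure.toSphere_apply' _ hmeas, mul_assoc, mul_comm (ν _)]
  gcongr
  refine (measure_mono ?_).trans (addHaar_slab_le ν (norm_eq_of_mem_sphere u) hε hε₁)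
  rintro _ ⟨r, ⟨hr₀, hr₁⟩, _, ⟨v, hv, rfl⟩, rfl⟩
  have hv : |inner ℝ (u : F) (v : F)| < ε := hv
  constructor
  · simpa [norm_smul, abs_of_pos hr₀] using hr₁.le
  · simp only [inner_smul_right, abs_mul, abs_of_pos hr₀]
    exact (mul_le_of_le_one_left (abs_nonneg _) hr₁.le).trans_lt hv

theorem integrable_abs_inner_rpow_neg (u : Metric.sphere (0 : F) 1) {r : ℝ} (hr : 0 < r)
    (hr₁ : r < 1) :
    Integrable (fun v : Metric.sphere (0 : F) 1 => |inner ℝ (u : F) (v : F)| ^ (-r)) ν.toSphere :=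
  integrable_rpow_neg_of_measure_lt_le
    (f := fun v : Metric.sphere (0 : F) 1 => |inner ℝ (u : F) (v : F)|)
    (Continuous.measurable (by fun_prop))
    (fun _ => abs_nonneg _)
    (ENNReal.mul_ne_top (ENNReal.natCast_ne_top _) measure_closedBall_lt_top.ne)
    (fun _ hε hε₁ => toSphere_slab_le ν u hε hε₁) hr hr₁

end SphereMeasure

/-- Spherical Lebesgue measure on `S^{n-1}`, the measure `dv` in the definition of `entropy`. -/
abbrev sphereMeasure (n : ℕ) : Measure (S n) :=
  (volume : Measure (E n)).toSphere

section Gauge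

variable {n : ℕ} {K : Set (E n)}

theorem IsBodyE.isBodyO (hK : IsBodyE K) : IsBodyO K := by
  refine ⟨hK.convex, hK.isCompact, ?_⟩
  have hneg : -K = K := by
    ext x
    exact ⟨fun hx => by simpa using hK.symmetric _ hx, hK.symmetric x⟩
  obtain ⟨x, hx⟩ := hK.interior_nonempty
  have hx' : -x ∈ interior (-K) :=
    ((Homeomorph.neg (E n)).preimage_interior K).subset (by simpa using hx)
  rw [hneg] at hx'
  simpa [midpoint_eq_smul_add] using hK.convex.interior.midpoint_mem hx hx'

theorem IsBodyO.mem_nhds (hK : IsBodyO K) : K ∈ 𝓝 0 :=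
  mem_interior_iff_mem_nhds.1 hK.zero_mem_interior

theorem IsBodyO.continuous_gauge (hK : IsBodyO K) : Continuous (gauge K) :=
  _root_.continuous_gauge hK.convex hK.mem_nhds

theorem IsBodyO.gauge_pos (hK : IsBodyO K) {x : E n} (hx : x ≠ 0) : 0 < gauge K x :=
  (_root_.gauge_pos (absorbent_nhds_zero hK.mem_nhds)
    (hK.isCompact.isVonNBounded ℝ)).2 hx

theorem IsBodyO.continuous_gauge_rpow (hK : IsBodyO K) (p : ℝ) :
    Continuous fun u : S n => gauge K u ^ p :=
  (hK.continuous_gauge.comp continuous_subtype_val).rpow_const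
    fun u => .inl (hK.gauge_pos (ne_zero_of_mem_unit_sphere u)).ne'

theorem IsBodyO.gauge_le_one_iff (hK : IsBodyO K) {x : E n} : gauge K x ≤ 1 ↔ x ∈ K := by
  rw [gauge_le_one_iff_mem_closure hK.convex hK.mem_nhds, hK.isCompact.isClosed.closure_eq]

theorem IsBodyO.gauge_inv_smul (hK : IsBodyO K) {x : E n} (hx : x ≠ 0) :
    gauge K ((gauge K x)⁻¹ • x) = 1 := by
  rw [gauge_smul_of_nonneg (inv_nonneg.2 (gauge_nonneg x)), smul_eq_mul,
    inv_mul_cancel₀ (hK.gauge_pos hx).ne']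

theorem IsBodyO.gauge_inv_smul_mem (hK : IsBodyO K) {x : E n} (hx : x ≠ 0) :
    (gauge K x)⁻¹ • x ∈ K :=
  hK.gauge_le_one_iff.1 (hK.gauge_inv_smul hx).le

theorem IsBodyO.radialFn_eq (hK : IsBodyO K) {x : E n} (hx : x ≠ 0) :
    radialFn K x = (gauge K x)⁻¹ := by
  refine IsGreatest.csSup_eq ⟨hK.gauge_inv_smul_mem hx, fun r hr => ?_⟩
  rcases le_or_gt r 0 with hr₀ | hr₀
  · exact hr₀.trans (inv_nonneg.2 (gauge_nonneg x))
  · rw [← one_div, le_div_iff₀ (hK.gauge_pos hx), ← smul_eq_mul, ← gauge_smul_of_nonneg hr₀.le]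
    exact hK.gauge_le_one_iff.2 hr

theorem IsBodyO.supportFn_polarBody (hK : IsBodyO K) {x : E n} (hx : x ≠ 0) :
    supportFn (polarBody K) x = gauge K x := by
  have hg := hK.gauge_pos hx
  refine IsGreatest.csSup_eq ⟨?_, ?_⟩
  · have hnot : (gauge K x)⁻¹ • x ∉ interior K := fun h =>
      (interior_subset_gauge_lt_one K h).ne (hK.gauge_inv_smul hx)
    obtain ⟨f, hfx, hf⟩ := separate_convex_open_set hK.zero_mem_interior hK.convex.interior
      isOpen_interior hnot
    refine ⟨(InnerProductSpace.toDual ℝ (E n)).symm f, fun y hy => ?_, ?_⟩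
    · have hy : y ∈ closure (interior K) :=
        (hK.convex.closure_interior_eq_closure_of_nonempty_interior
          ⟨0, hK.zero_mem_interior⟩).ge (subset_closure hy)
      rw [InnerProductSpace.toDual_symm_apply]
      exact closure_minimal (fun z hz => (hf z hz).le)
        (isClosed_le f.continuous continuous_const) hy
    · rw [map_smul, smul_eq_mul, inv_mul_eq_one₀ hg.ne'] at hfx
      simp only [InnerProductSpace.toDual_symm_apply, hfx]
  · rintro _ ⟨y, hy, rfl⟩
    have := hy _ (hK.gauge_inv_smul_mem hx)
    rwa [inner_smul_right, inv_mul_le_one₀ hg] at this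

end Gauge

section WulffShape

variable {n : ℕ}

theorem supportFn_polarBody_wulffShape {f : S n → ℝ} (hf : Continuous f) (hf₀ : ∀ u, 0 < f u)
    (v : S n) :
    supportFn (polarBody (wulffShape f)) v = ⨆ u : S n, inner ℝ (u : E n) (v : E n) / f u := by
  have : Nonempty (S n) := ⟨v⟩
  have hc : Continuous fun u : S n => inner ℝ (u : E n) (v : E n) / f u :=
    Continuous.div (by fun_prop) hf fun u => (hf₀ u).ne'
  obtain ⟨u₀, hu₀⟩ := exists_eq_iSup_of_continuous hc
  have hsup_pos : 0 < ⨆ u : S n, inner ℝ (u : E n) (v : E n) / f u :=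
    (div_pos (by simp) (hf₀ v)).trans_le (le_iSup_of_continuous hc v)
  refine IsGreatest.csSup_eq ⟨⟨(f u₀)⁻¹ • (u₀ : E n), fun x hx => ?_, ?_⟩, ?_⟩
  · rw [real_inner_smul_left, inv_mul_le_one₀ (hf₀ u₀), real_inner_comm]
    exact hx u₀
  · simp only [real_inner_smul_left, ← hu₀, inv_mul_eq_div]
  · rintro _ ⟨y, hy, rfl⟩
    have hmem : (⨆ u : S n, inner ℝ (u : E n) (v : E n) / f u)⁻¹ • (v : E n) ∈ wulffShape f := by
      intro u
      rw [real_inner_smul_left, inv_mul_le_iff₀ hsup_pos, ← div_le_iff₀ (hf₀ u), real_inner_comm]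
      exact le_iSup_of_continuous hc u
    have := hy _ hmem
    rwa [inner_smul_right, inv_mul_le_one₀ hsup_pos] at this

theorem log_supportFn_polarBody_wulffShape {p : ℝ} (hp : p < 0) {b : S n → ℝ} (hb : Continuous b)
    (hb₀ : ∀ u, 0 < b u) (v : S n) :
    Real.log (supportFn (polarBody (wulffShape fun u => b u ^ (1 / p))) v) =
      -(1 / p) * Real.log (⨆ u : S n, max (inner ℝ (u : E n) (v : E n)) 0 ^ (-p) * b u) := by
  have : Nonempty (S n) := ⟨v⟩
  have hroot₀ (u : S n) : 0 < b u ^ (1 / p) := Real.rpow_pos_of_pos (hb₀ u) _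
  have hroot : Continuous fun u => b u ^ (1 / p) := hb.rpow_const fun u => .inl (hb₀ u).ne'
  have hc : Continuous fun u : S n => inner ℝ (u : E n) (v : E n) / b u ^ (1 / p) :=
    Continuous.div (by fun_prop) hroot fun u => (hroot₀ u).ne'
  have hsup_pos : 0 < ⨆ u : S n, inner ℝ (u : E n) (v : E n) / b u ^ (1 / p) :=
    (div_pos (by simp) (hroot₀ v)).trans_le (le_iSup_of_continuous hc v)
  have hmono : Monotone fun x : ℝ => max x 0 ^ (-p) := fun x y hxy =>
    Real.rpow_le_rpow (le_max_right _ _) (max_le_max_right 0 hxy) (neg_nonneg.2 hp.le)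
  have hcont : Continuous fun x : ℝ => max x 0 ^ (-p) :=
    (continuous_id.max continuous_const).rpow_const fun _ => .inr (neg_nonneg.2 hp.le)
  have hpow (u : S n) : max (inner ℝ (u : E n) (v : E n) / b u ^ (1 / p)) 0 ^ (-p) =
      max (inner ℝ (u : E n) (v : E n)) 0 ^ (-p) * b u := by
    rw [← zero_div (b u ^ (1 / p)), max_div_div_right (hroot₀ u).le, zero_div,
      Real.div_rpow (le_max_right _ _) (hroot₀ u).le, ← Real.rpow_mul (hb₀ u).le, mul_neg,
      one_div_mul_cancel hp.ne, Real.rpow_neg_one, div_inv_eq_mul]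
  have hsup := hmono.map_ciSup_of_continuousAt hcont.continuousAt (isCompact_range hc).bddAbove
  simp only [hpow] at hsup
  rw [supportFn_polarBody_wulffShape hroot hroot₀, ← hsup, max_eq_left hsup_pos.le,
    Real.log_rpow hsup_pos, ← mul_assoc, neg_mul_neg, one_div_mul_cancel hp.ne, one_mul]

end WulffShape

section ExposedPoint

variable {n : ℕ} {K Q : Set (E n)} {v : S n} {x : E n} {p : ℝ}

/-- `x` is the only point of `K` whose support hyperplane has outer normal `v`: the point of `K`
exposed by the functional `⟪·, v⟫`. -/
def IsExposedBy (K : Set (E n)) (v : S n) (x : E n) : Prop :=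
  x ∈ K ∧ ∀ y ∈ K, y ≠ x → inner ℝ y (v : E n) < inner ℝ x (v : E n)

theorem IsExposedBy.inner_pos (hx : IsExposedBy K v x) (hK : IsBodyO K) :
    0 < inner ℝ x (v : E n) := by
  have hv : (v : E n) ≠ 0 := ne_zero_of_mem_unit_sphere v
  have hpos : 0 < inner ℝ ((gauge K (v : E n))⁻¹ • (v : E n)) (v : E n) := by
    simpa [real_inner_smul_left] using hK.gauge_pos hv
  by_cases h : (gauge K (v : E n))⁻¹ • (v : E n) = x
  · rwa [← h]
  · exact hpos.trans (hx.2 _ (hK.gauge_inv_smul_mem hv) h)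

theorem IsExposedBy.gauge_eq_one (hx : IsExposedBy K v x) (hK : IsBodyO K) : gauge K x = 1 := by
  have hpos := hx.inner_pos hK
  have hx₀ : x ≠ 0 := by
    rintro rfl
    simp at hpos
  have hg := hK.gauge_pos hx₀
  refine le_antisymm (hK.gauge_le_one_iff.2 hx.1) (not_lt.1 fun hlt => ?_)
  have := hx.2 _ (hK.gauge_inv_smul_mem hx₀) fun h => hlt.ne (h ▸ hK.gauge_inv_smul hx₀)
  rw [real_inner_smul_left, mul_lt_iff_lt_one_left hpos] at this
  exact this.not_gt ((one_lt_inv₀ hg).2 hlt)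

theorem IsBodyO.max_inner_rpow_mul_gauge_rpow (hK : IsBodyO K) (u v : S n) :
    max (inner ℝ (u : E n) (v : E n)) 0 ^ (-p) * gauge K u ^ p =
      max (inner ℝ ((gauge K u)⁻¹ • (u : E n)) (v : E n)) 0 ^ (-p) := by
  have hg := inv_pos.2 (hK.gauge_pos (ne_zero_of_mem_unit_sphere u))
  rw [real_inner_smul_left, ← mul_zero (gauge K (u : E n))⁻¹, ← mul_max_of_nonneg _ _ hg.le,
    mul_zero, Real.mul_rpow hg.le (le_max_right _ _), Real.inv_rpow (gauge_nonneg _),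
    Real.rpow_neg (gauge_nonneg _), inv_inv, mul_comm]

theorem IsExposedBy.exists_sphere_forall_lt (hx : IsExposedBy K v x) (hK : IsBodyO K)
    (hp : p < 0) :
    ∃ u₀ : S n, (∀ u : S n, u ≠ u₀ → max (inner ℝ (u : E n) (v : E n)) 0 ^ (-p) * gauge K u ^ p <
        max (inner ℝ (u₀ : E n) (v : E n)) 0 ^ (-p) * gauge K u₀ ^ p) ∧
      0 < inner ℝ (u₀ : E n) (v : E n) ∧
      ∀ Q : Set (E n), gauge Q u₀ ^ p / gauge K u₀ ^ p = gauge Q x ^ p := by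
  have hpos := hx.inner_pos hK
  have hx₀ : 0 < ‖x‖ := norm_pos_iff.2 (by rintro rfl; simp at hpos)
  obtain ⟨u₀, hu₀⟩ : ∃ u₀ : S n, ‖x‖ • (u₀ : E n) = x :=
    ⟨⟨‖x‖⁻¹ • x, by simp [norm_smul, hx₀.ne']⟩, smul_inv_smul₀ hx₀.ne' x⟩
  have hgauge : gauge K (u₀ : E n) = ‖x‖⁻¹ := by
    rw [← mul_eq_one_iff_eq_inv₀ hx₀.ne', mul_comm, ← smul_eq_mul,
      ← gauge_smul_of_nonneg hx₀.le, hu₀, hx.gauge_eq_one hK]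
  refine ⟨u₀, fun u hu => ?_, ?_, fun Q => ?_⟩
  · have hgu := inv_pos.2 (hK.gauge_pos (ne_zero_of_mem_unit_sphere u))
    have hne : (gauge K (u : E n))⁻¹ • (u : E n) ≠ x := by
      intro h
      refine hu (Subtype.ext ?_)
      have hnorm : (gauge K (u : E n))⁻¹ = ‖x‖ := by
        rw [← h, norm_smul, norm_eq_of_mem_sphere, mul_one, Real.norm_of_nonneg hgu.le]
      rw [hnorm, ← hu₀, norm_smul, norm_norm, norm_eq_of_mem_sphere, mul_one] at h
      exact smul_right_injective _ hx₀.ne' h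
    rw [hK.max_inner_rpow_mul_gauge_rpow, hK.max_inner_rpow_mul_gauge_rpow, hgauge, inv_inv, hu₀,
      max_eq_left hpos.le]
    exact Real.rpow_lt_rpow (le_max_right _ _)
      (max_lt (hx.2 _ (hK.gauge_inv_smul_mem (ne_zero_of_mem_unit_sphere u)) hne) hpos)
      (neg_pos.2 hp)
  · rw [← hu₀, real_inner_smul_left] at hpos
    exact pos_of_mul_pos_right hpos hx₀.le
  · rw [← Real.div_rpow (gauge_nonneg _) (gauge_nonneg _), hgauge, div_inv_eq_mul, mul_comm,
      ← smul_eq_mul, ← gauge_smul_of_nonneg hx₀.le, hu₀]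

theorem entropy_harmonicCombination (hp : p < 0) (hK : IsBodyO K) (hQ : IsBodyO Q) {t : ℝ}
    (ht : ∀ u : S n, 0 < gauge K u ^ p + t * gauge Q u ^ p) :
    entropy (harmonicCombination p K t Q) = 1 / p * ∫ v : S n, Real.log (⨆ u : S n,
      max (inner ℝ (u : E n) (v : E n)) 0 ^ (-p) * (gauge K u ^ p + t * gauge Q u ^ p))
        ∂sphereMeasure n := by
  have hb : Continuous fun u : S n => gauge K u ^ p + t * gauge Q u ^ p :=
    (hK.continuous_gauge_rpow p).add ((hQ.continuous_gauge_rpow p).const_mul t)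
  simp only [entropy, harmonicCombination, lpCombination,
    hK.supportFn_polarBody (ne_zero_of_mem_unit_sphere _),
    hQ.supportFn_polarBody (ne_zero_of_mem_unit_sphere _),
    log_supportFn_polarBody_wulffShape hp hb ht, neg_mul, integral_neg, neg_neg, integral_const_mul]

theorem eventually_forall_pos_add_mul {X : Type*} [TopologicalSpace X] [CompactSpace X]
    {b c : X → ℝ} (hb : Continuous b) (hc : Continuous c) (hb₀ : ∀ x, 0 < b x) :
    ∀ᶠ t in 𝓝 (0 : ℝ), ∀ x, 0 < b x + t * c x := by
  have h := isCompact_univ.eventually_forall_of_forall_eventually (x₀ := (0 : ℝ))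
    (P := fun t x => 0 < b x + t * c x) fun x _ => by
      have hcont : Continuous fun z : ℝ × X => b z.2 + z.1 * c z.2 := by fun_prop
      exact hcont.continuousAt.eventually_const_lt (by simpa using hb₀ x)
  simpa only [mem_univ, true_imp_iff] using h

theorem hasDerivAt_entropy_harmonicCombination [Nonempty (S n)] (hp : p < 0) (hK : IsBodyO K)
    (hQ : IsBodyO Q) {x : S n → E n}
    (hx : ∀ᵐ v ∂sphereMeasure n, IsExposedBy K v (x v)) :
    HasDerivAt (fun t : ℝ => entropy (harmonicCombination p K t Q))
      (1 / p * ∫ v, gauge Q (x v) ^ p ∂sphereMeasure n) 0 := by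
  obtain ⟨u, hu⟩ := skolem.1 (hx.mono fun v hv => hv.exists_sphere_forall_lt hK hp)
  have hweight {L : Set (E n)} (hL : IsBodyO L) : Continuous fun z : S n × S n =>
      max (inner ℝ (z.2 : E n) (z.1 : E n)) 0 ^ (-p) * gauge L z.2 ^ p :=
    (Continuous.rpow_const (by fun_prop) fun _ => .inr (neg_nonneg.2 hp.le)).mul
      ((hL.continuous_gauge_rpow p).comp continuous_snd)
  have hgaugeK (u : S n) : 0 < gauge K u ^ p :=
    Real.rpow_pos_of_pos (hK.gauge_pos (ne_zero_of_mem_unit_sphere u)) p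
  have hderiv := hasDerivAt_integral_log_iSup_add_mul
    (σ := sphereMeasure n)
    (g := fun v (u : S n) => max (inner ℝ (u : E n) (v : E n)) 0 ^ (-p) * gauge K u ^ p)
    (h := fun v (u : S n) => max (inner ℝ (u : E n) (v : E n)) 0 ^ (-p) * gauge Q u ^ p)
    (hweight hK) (hweight hQ)
    (fun v => ⟨v, by simpa using hgaugeK v⟩) (hu.mono fun v hv => hv.1)
  have hratio : ∀ᵐ v ∂sphereMeasure n,
      max (inner ℝ (u v : E n) (v : E n)) 0 ^ (-p) * gauge Q (u v) ^ p /
        (max (inner ℝ (u v : E n) (v : E n)) 0 ^ (-p) * gauge K (u v) ^ p) =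
      gauge Q (x v) ^ p := by
    filter_upwards [hu] with v ⟨_, hpos, hQv⟩
    rw [max_eq_left hpos.le, mul_div_mul_left _ _ (Real.rpow_pos_of_pos hpos _).ne', hQv]
  rw [integral_congr_ae hratio] at hderiv
  refine (hderiv.const_mul (1 / p)).congr_of_eventuallyEq ?_
  filter_upwards [eventually_forall_pos_add_mul (hK.continuous_gauge_rpow p)
    (hQ.continuous_gauge_rpow p) hgaugeK] with t ht
  rw [entropy_harmonicCombination hp hK hQ ht]
  simp only [mul_add, mul_left_comm t]

theorem isLpIntegralCurvature_iff [Nonempty (S n)] (hp : p < 0) (hK : IsBodyO K) {x : S n → E n}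
    (hx : ∀ᵐ v ∂sphereMeasure n, IsExposedBy K v (x v)) {μ : Measure (S n)} :
    IsLpIntegralCurvature p K μ ↔ ∀ Q : Set (E n), IsBodyO Q →
      ∫ u : S n, gauge Q u ^ p ∂μ = ∫ v, gauge Q (x v) ^ p ∂sphereMeasure n := by
  refine forall₂_congr fun Q hQ => ?_
  have hradial (u : S n) : radialFn Q u ^ (-p) = gauge Q u ^ p := by
    rw [hQ.radialFn_eq (ne_zero_of_mem_unit_sphere u), Real.inv_rpow (gauge_nonneg _),
      Real.rpow_neg (gauge_nonneg _), inv_inv]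
  have hderiv := hasDerivAt_entropy_harmonicCombination hp hK hQ hx
  simp only [hradial]
  exact ⟨fun h => mul_left_cancel₀ (one_div_ne_zero hp.ne) (h.unique hderiv), fun h => h ▸ hderiv⟩

end ExposedPoint

section ExposedVertex

variable {n : ℕ} {ι : Type*} {ξ : ι → E n}

/-- The outer unit normals that expose `ξ i` in the polytope spanned by the points `ξ j`. -/
abbrev normalCell (ξ : ι → E n) (i : ι) : Set (S n) :=
  dominanceCell (fun i (v : S n) => inner ℝ (ξ i) (v : E n)) i

theorem isExposedBy_convexHull_of_mem_normalCell {i : ι} {v : S n} (hv : v ∈ normalCell ξ i) :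
    IsExposedBy (convexHull ℝ (range ξ)) v (ξ i) := by
  refine ⟨subset_convexHull ℝ _ (mem_range_self i), ?_⟩
  suffices convexHull ℝ (range ξ) ⊆
      {x | x = ξ i ∨ inner ℝ x (v : E n) < inner ℝ (ξ i) (v : E n)} from
    fun y hy hne => (this hy).resolve_left hne
  refine convexHull_min ?_ (convex_iff_forall_pos.2 ?_)
  · rintro _ ⟨j, rfl⟩
    exact (eq_or_ne j i).imp (congrArg ξ) (hv j)
  · intro x hx y hy a b ha hb hab
    obtain rfl : b = 1 - a := by linarith
    rcases hx with rfl | hx <;> rcases hy with rfl | hy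
    · exact .inl (by rw [← add_smul, hab, one_smul])
    all_goals
      refine .inr ?_
      rw [inner_add_left, real_inner_smul_left, real_inner_smul_left]
      nlinarith

theorem ae_inner_ne_inner {x y : E n} (hxy : x ≠ y) :
    ∀ᵐ v : S n ∂sphereMeasure n, inner ℝ x (v : E n) ≠ inner ℝ y (v : E n) := by
  filter_upwards [ae_toSphere_inner_ne_zero volume (sub_ne_zero.2 hxy)] with v hv
  rwa [inner_sub_left, sub_ne_zero] at hv

theorem exists_ae_mem_normalCell [Finite ι] [Nonempty ι] (hξ : Function.Injective ξ) :
    ∃ i : S n → ι, ∀ᵐ v ∂sphereMeasure n, v ∈ normalCell ξ (i v) :=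
  exists_ae_mem_dominanceCell fun _ _ hij => ae_inner_ne_inner (hξ.ne hij)

theorem isOpen_normalCell [Finite ι] (ξ : ι → E n) (i : ι) : IsOpen (normalCell ξ i) :=
  isOpen_dominanceCell (fun _ => by fun_prop) i

theorem isLpIntegralCurvature_convexHull_iff [Nonempty (S n)] [Fintype ι] [Nonempty ι] {p : ℝ}
    (hp : p < 0) (hξ : Function.Injective ξ) (hK : IsBodyO (convexHull ℝ (range ξ)))
    {μ : Measure (S n)} :
    IsLpIntegralCurvature p (convexHull ℝ (range ξ)) μ ↔ ∀ Q : Set (E n), IsBodyO Q →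
      ∫ u : S n, gauge Q u ^ p ∂μ =
        ∑ i, (sphereMeasure n).real (normalCell ξ i) * gauge Q (ξ i) ^ p := by
  obtain ⟨i, hi⟩ := exists_ae_mem_normalCell hξ
  rw [isLpIntegralCurvature_iff hp hK
    (hi.mono fun v hv => isExposedBy_convexHull_of_mem_normalCell hv)]
  refine forall₂_congr fun Q _ => ?_
  rw [integral_comp_dominanceCell_index
    (fun i => (isOpen_normalCell ξ i).measurableSet) hi fun i => gauge Q (ξ i) ^ p]

end ExposedVertex

section Seminorm

variable {n : ℕ} {N : Seminorm ℝ (E n)}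

theorem isBodyO_seminorm_closedBall (hN : Continuous N) (hle : ∀ x, ‖x‖ ≤ N x) :
    IsBodyO (N.closedBall 0 1) where
  convex := N.convex_closedBall 0 1
  isCompact := by
    rw [N.closedBall_zero_eq]
    refine Metric.isCompact_of_isClosed_isBounded (isClosed_le hN continuous_const) ?_
    exact isBounded_iff_forall_norm_le.2 ⟨1, fun x hx => (hle x).trans hx⟩
  zero_mem_interior := by
    rw [mem_interior_iff_mem_nhds, N.closedBall_zero_eq]
    exact hN.continuousAt.eventually_le_const (by simp)

theorem gauge_seminorm_closedBall (hN : Continuous N) (hle : ∀ x, ‖x‖ ≤ N x) (x : E n) :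
    gauge (N.closedBall 0 1) x = N x := by
  have hbody := isBodyO_seminorm_closedBall hN hle
  rcases eq_or_ne x 0 with rfl | hx
  · simp
  have hgauge := hbody.gauge_pos hx
  have hNx : 0 < N x := (norm_pos_iff.2 hx).trans_le (hle x)
  refine le_antisymm (gauge_le_of_mem hNx.le ?_) ?_
  · rw [mem_smul_set_iff_inv_smul_mem₀ hNx.ne', N.mem_closedBall_zero, map_smul_eq_mul,
      Real.norm_of_nonneg (inv_nonneg.2 hNx.le), inv_mul_cancel₀ hNx.ne']
  · have := hbody.gauge_inv_smul_mem hx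
    rwa [N.mem_closedBall_zero, map_smul_eq_mul, Real.norm_of_nonneg (inv_nonneg.2 hgauge.le),
      inv_mul_le_one₀ hgauge] at this

end Seminorm

section Necessity

variable {n : ℕ}

theorem exists_nonempty_normalCell_inner_ne_zero {ι : Type*} [Finite ι] [Nonempty ι] {ξ : ι → E n}
    (hξ : Function.Injective ξ) (hK : IsBodyO (convexHull ℝ (range ξ))) {w : E n} (hw : w ≠ 0) :
    ∃ i, (normalCell ξ i).Nonempty ∧ inner ℝ (ξ i) w ≠ 0 := by
  by_contra! hzero
  let v₀ : S n := ⟨‖w‖⁻¹ • w, by simp [norm_smul, hw]⟩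
  let A : Set (S n) := ⋃ i ∈ {i | inner ℝ (ξ i) w = 0}, ⋂ y ∈ convexHull ℝ (range ξ),
    {v : S n | inner ℝ y (v : E n) ≤ inner ℝ (ξ i) (v : E n)}
  have hA : IsClosed A := (toFinite _).isClosed_biUnion fun i _ =>
    isClosed_biInter fun y _ => isClosed_le (by fun_prop) (by fun_prop)
  have hdense : Dense A := by
    obtain ⟨i, hi⟩ := exists_ae_mem_normalCell hξ
    refine Measure.dense_of_ae (μ := sphereMeasure n) (hi.mono fun v hv => ?_)
    have hexp := isExposedBy_convexHull_of_mem_normalCell hv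
    refine mem_biUnion (hzero _ ⟨v, hv⟩) (mem_iInter₂.2 fun y hy => ?_)
    rcases eq_or_ne y (ξ (i v)) with rfl | hne
    · exact le_refl (inner ℝ _ _)
    · exact (hexp.2 y hy hne).le
  obtain ⟨i, hi, hmax⟩ := mem_iUnion₂.1 (hA.closure_eq ▸ hdense v₀)
  have hv₀ : (v₀ : E n) ≠ 0 := ne_zero_of_mem_unit_sphere v₀
  have hle : inner ℝ ((gauge (convexHull ℝ (range ξ)) v₀)⁻¹ • (v₀ : E n)) (v₀ : E n) ≤
      inner ℝ (ξ i) (v₀ : E n) := mem_iInter₂.1 hmax _ (hK.gauge_inv_smul_mem hv₀)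
  have hi : inner ℝ (ξ i) w = 0 := hi
  have hzero : inner ℝ (ξ i) (v₀ : E n) = 0 := by simp only [v₀, inner_smul_right, hi, mul_zero]
  rw [hzero, real_inner_smul_left, real_inner_self_eq_norm_sq, norm_eq_of_mem_sphere, one_pow,
    mul_one] at hle
  exact hle.not_gt (inv_pos.2 (hK.gauge_pos hv₀))

theorem integral_seminorm_rpow [Nonempty (S n)] {ι : Type*} [Fintype ι] [Nonempty ι] {ξ : ι → E n}
    {p : ℝ} (hp : p < 0) (hξ : Function.Injective ξ) (hK : IsBodyO (convexHull ℝ (range ξ)))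
    {μ : Measure (S n)} (hμ : IsLpIntegralCurvature p (convexHull ℝ (range ξ)) μ)
    {N : Seminorm ℝ (E n)} (hN : Continuous N) (hle : ∀ x, ‖x‖ ≤ N x) :
    ∫ u : S n, N u ^ p ∂μ = ∑ j, (sphereMeasure n).real (normalCell ξ j) * N (ξ j) ^ p := by
  simpa only [gauge_seminorm_closedBall hN hle] using
    (isLpIntegralCurvature_convexHull_iff hp hξ hK).1 hμ _ (isBodyO_seminorm_closedBall hN hle)

theorem measure_compl_greatSubsphere_ne_zero_of_convexHull_range {ι : Type*} [Finite ι]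
    [Nonempty ι] {ξ : ι → E n} {p : ℝ} (hp : p < 0) (hξ : Function.Injective ξ)
    (hK : IsBodyO (convexHull ℝ (range ξ))) {μ : Measure (S n)}
    (hμ : IsLpIntegralCurvature p (convexHull ℝ (range ξ)) μ) {w : E n} (hw : w ≠ 0) :
    μ (greatSubsphere w)ᶜ ≠ 0 := by
  cases nonempty_fintype ι
  have : Nonempty (S n) := ⟨⟨‖w‖⁻¹ • w, by simp [norm_smul, hw]⟩⟩
  intro hzero
  let N₀ : Seminorm ℝ (E n) := normSeminorm ℝ (E n)
  let N₁ : Seminorm ℝ (E n) := N₀ + (innerₗ (E n) w).toSeminorm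
  have hN₀ : Continuous N₀ := continuous_norm
  have hN₁ : Continuous N₁ :=
    continuous_norm.add (by fun_prop : Continuous fun x => ‖inner ℝ w x‖)
  have hN₁_apply (x : E n) : N₁ x = ‖x‖ + |inner ℝ x w| := by
    rw [real_inner_comm]; rfl
  have hle₁ (x : E n) : N₀ x ≤ N₁ x := (hN₁_apply x).symm ▸ le_add_of_nonneg_right (abs_nonneg _)
  have hagree : ∫ u : S n, N₀ u ^ p ∂μ = ∫ u : S n, N₁ u ^ p ∂μ := by
    refine integral_congr_ae ((measure_eq_zero_iff_ae_notMem.1 hzero).mono fun u hu => ?_)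
    have hu : inner ℝ (u : E n) w = 0 := not_not.1 hu
    simp only [hN₁_apply, hu, abs_zero, add_zero]
    rfl
  rw [integral_seminorm_rpow hp hξ hK hμ hN₀ fun _ => le_rfl,
    integral_seminorm_rpow hp hξ hK hμ hN₁ hle₁, eq_comm] at hagree
  obtain ⟨i, hi, hiw⟩ := exists_nonempty_normalCell_inner_ne_zero hξ hK hw
  have hcell : 0 < (sphereMeasure n).real (normalCell ξ i) :=
    ENNReal.toReal_pos_iff.2 ⟨(isOpen_normalCell ξ i).measure_pos _ hi, measure_lt_top _ _⟩
  have hnorm : 0 < ‖ξ i‖ := norm_pos_iff.2 fun h => hiw (by rw [h, inner_zero_left])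
  have hlt : N₁ (ξ i) ^ p < N₀ (ξ i) ^ p := Real.rpow_lt_rpow_of_neg hnorm
    ((hN₁_apply _).symm ▸ lt_add_of_pos_right _ (abs_pos.2 hiw)) hp
  refine (Finset.sum_lt_sum (fun j _ => ?_) ⟨i, Finset.mem_univ _, ?_⟩).ne hagree
  · gcongr ?_ * ?_
    rcases eq_or_ne (ξ j) 0 with hj | hj
    · simp [hj]
    · exact Real.rpow_le_rpow_of_nonpos (norm_pos_iff.2 hj) (hle₁ _) hp.le
  · gcongr

theorem IsPolytope.measure_compl_greatSubsphere_ne_zero {K : Set (E n)} (hKp : IsPolytope K)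
    (hK : IsBodyO K) {p : ℝ} (hp : p < 0) {μ : Measure (S n)} (hμ : IsLpIntegralCurvature p K μ)
    {w : E n} (hw : w ≠ 0) : μ (greatSubsphere w)ᶜ ≠ 0 := by
  obtain ⟨F, rfl⟩ := hKp
  have : Nonempty F :=
    (convexHull_nonempty_iff.1 ⟨0, interior_subset hK.zero_mem_interior⟩).to_subtype
  rw [← Subtype.range_coe (s := (F : Set (E n)))] at hK hμ
  exact measure_compl_greatSubsphere_ne_zero_of_convexHull_range hp Subtype.val_injective hK hμ hw

end Necessity

section SymmetricPolytope

variable {n : ℕ} {ι : Type*}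

theorem isBodyE_convexHull_range [Finite ι] [Nonempty ι] {ξ : ι → E n}
    (hneg : ∀ i, -ξ i ∈ range ξ) (hspan : ∀ w : E n, w ≠ 0 → ∃ i, inner ℝ (ξ i) w ≠ 0) :
    IsBodyE (convexHull ℝ (range ξ)) where
  convex := convex_convexHull ℝ _
  isCompact := (finite_range ξ).isCompact_convexHull (𝕜 := ℝ)
  interior_nonempty := by
    rw [interior_convexHull_nonempty_iff_affineSpan_eq_top,
      AffineSubspace.affineSpan_eq_top_iff_vectorSpan_eq_top_of_nonempty ℝ (E n) (E n)
        (range_nonempty ξ), ← Submodule.orthogonal_eq_bot_iff, Submodule.eq_bot_iff]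
    intro w hw
    by_contra hne
    obtain ⟨i, hi⟩ := hspan w hne
    have horth := hw _ (vsub_mem_vectorSpan ℝ (mem_range_self i) (hneg i))
    rw [vsub_eq_sub, sub_neg_eq_add, inner_add_left] at horth
    exact hi (by linarith)
  symmetric x hx := by
    have hsub : range ξ ⊆ -range ξ := by
      rintro _ ⟨i, rfl⟩
      exact hneg i
    have hx' := convexHull_mono hsub hx
    rwa [convexHull_neg] at hx'

theorem eq_of_smul_sphere_eq {u v : S n} {c d : ℝ} (hc : 0 < c) (hd : 0 < d)
    (h : c • (u : E n) = d • (v : E n)) : u = v := by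
  have hcd : c = d := by
    simpa [norm_smul, abs_of_pos hc, abs_of_pos hd] using congrArg norm h
  subst hcd
  exact Subtype.ext (smul_right_injective _ hc.ne' h)

theorem injective_sumElim_smul_sphere {e : ι → S n} (he : Function.Injective e)
    (hneg : ∀ i j, e i ≠ -e j) {c : ι → ℝ} (hc : ∀ i, 0 < c i) :
    Function.Injective
      (Sum.elim (fun i => c i • (e i : E n)) (-fun i => c i • (e i : E n))) := by
  have hinj : Function.Injective fun i => c i • (e i : E n) := fun i j hij =>
    he (eq_of_smul_sphere_eq (hc i) (hc j) hij)
  refine hinj.sumElim (neg_injective.comp hinj) fun i j hij => hneg i j ?_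
  refine eq_of_smul_sphere_eq (hc i) (hc j) (hij.trans ?_)
  simp

theorem preimage_neg_normalCell_inl (ζ : ι → E n) (i : ι) :
    (fun v : S n => -v) ⁻¹' normalCell (Sum.elim ζ (-ζ)) (Sum.inl i) =
      normalCell (Sum.elim ζ (-ζ)) (Sum.inr i) := by
  ext v
  simp [normalCell, dominanceCell, Sum.forall, and_comm]

theorem forall_abs_lt_abs_iff {x : ι → ℝ} {i : ι} (hx : x i ≠ 0) :
    (∀ j, j ≠ i → |x j| < |x i|) ↔
      ((∀ j, j ≠ i → x j < x i) ∧ ∀ j, -x j < x i) ∨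
        ((∀ j, x j < -x i) ∧ ∀ j, j ≠ i → x i < x j) := by
  constructor
  · intro h
    rcases hx.lt_or_gt with hneg | hpos
    · right
      grind
    · left
      grind
  · grind

theorem dominanceCell_abs_inner_ae_eq {ζ : ι → E n} {i : ι} (hζ : ζ i ≠ 0) :
    dominanceCell (fun i (v : S n) => |inner ℝ (ζ i) (v : E n)|) i =ᵐ[sphereMeasure n]
      (normalCell (Sum.elim ζ (-ζ)) (Sum.inl i) ∪ normalCell (Sum.elim ζ (-ζ)) (Sum.inr i) :
        Set (S n)) := by
  filter_upwards [ae_toSphere_inner_ne_zero volume hζ] with v hv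
  refine propext ?_
  change (∀ j, j ≠ i → |inner ℝ (ζ j) (v : E n)| < |inner ℝ (ζ i) (v : E n)|) ↔ _ ∨ _
  simpa [normalCell, dominanceCell] using
    forall_abs_lt_abs_iff (x := fun j => inner ℝ (ζ j) (v : E n)) hv

theorem measureReal_normalCell_symmetric [Finite ι] {ζ : ι → E n} {i : ι} (hζ : ζ i ≠ 0) :
    (sphereMeasure n).real (normalCell (Sum.elim ζ (-ζ)) (Sum.inr i)) =
        (sphereMeasure n).real (normalCell (Sum.elim ζ (-ζ)) (Sum.inl i)) ∧
    2 * (sphereMeasure n).real (normalCell (Sum.elim ζ (-ζ)) (Sum.inl i)) =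
      (sphereMeasure n).real (dominanceCell (fun i (v : S n) => |inner ℝ (ζ i) (v : E n)|) i) := by
  have hmeas (k : ι ⊕ ι) : MeasurableSet (normalCell (Sum.elim ζ (-ζ)) k) :=
    (isOpen_normalCell _ k).measurableSet
  have hanti : (sphereMeasure n).real (normalCell (Sum.elim ζ (-ζ)) (Sum.inr i)) =
      (sphereMeasure n).real (normalCell (Sum.elim ζ (-ζ)) (Sum.inl i)) := by
    rw [← preimage_neg_normalCell_inl]
    exact (measurePreserving_neg_toSphere volume).measureReal_preimage (hmeas _).nullMeasurableSet
  refine ⟨hanti, ?_⟩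
  rw [measureReal_congr (dominanceCell_abs_inner_ae_eq hζ), measureReal_union
    (pairwise_disjoint_dominanceCell _ Sum.inl_ne_inr) (hmeas _), hanti, two_mul]

theorem dominanceCell_rpow {V : Type*} {f : ι → V → ℝ} (hf : ∀ i v, 0 ≤ f i v) {q : ℝ}
    (hq : 0 < q) (i : ι) : dominanceCell (fun i v => f i v ^ q) i = dominanceCell f i :=
  ext fun v => forall₂_congr fun j _ => Real.rpow_lt_rpow_iff (hf j v) (hf i v) hq

end SymmetricPolytope

section Weights

variable {n : ℕ} {ι : Type*}

theorem mul_abs_inner_rpow {a q : ℝ} (ha : 0 < a) (hq : 0 < q) (x y : E n) :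
    a * |inner ℝ x y| ^ q = |inner ℝ (a ^ q⁻¹ • x) y| ^ q := by
  have hc : 0 ≤ a ^ q⁻¹ := (Real.rpow_pos_of_pos ha _).le
  rw [real_inner_smul_left, abs_mul, abs_of_nonneg hc, Real.mul_rpow hc (abs_nonneg _),
    Real.rpow_inv_rpow ha.le hq.ne']

theorem ae_mul_abs_inner_rpow_ne {u v : S n} (huv : u ≠ v) (huv' : u ≠ -v) {a b q : ℝ}
    (ha : 0 < a) (hb : 0 < b) (hq : 0 < q) :
    ∀ᵐ x : S n ∂sphereMeasure n,
      a * |inner ℝ (u : E n) (x : E n)| ^ q ≠ b * |inner ℝ (v : E n) (x : E n)| ^ q := by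
  have ha' := Real.rpow_pos_of_pos ha q⁻¹
  have hb' := Real.rpow_pos_of_pos hb q⁻¹
  have hne : a ^ q⁻¹ • (u : E n) ≠ b ^ q⁻¹ • (v : E n) := mt (eq_of_smul_sphere_eq ha' hb') huv
  have hne' : a ^ q⁻¹ • (u : E n) ≠ b ^ q⁻¹ • ((-v : S n) : E n) :=
    mt (eq_of_smul_sphere_eq ha' hb') huv'
  filter_upwards [ae_inner_ne_inner hne, ae_inner_ne_inner hne'] with x hx hx'
  rw [mul_abs_inner_rpow ha hq, mul_abs_inner_rpow hb hq, Ne,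
    Real.rpow_left_inj (abs_nonneg _) (abs_nonneg _) hq.ne', abs_eq_abs, not_or]
  rw [coe_neg_sphere, smul_neg, inner_neg_left] at hx'
  exact ⟨hx, hx'⟩

theorem exists_pos_measureReal_dominanceCell_abs_inner_eq [Nonempty (S n)] [Finite ι] [Nonempty ι]
    {e : ι → S n} (he : Function.Injective e) (hneg : ∀ i j, e i ≠ -e j)
    (hspan : ∀ w : E n, w ≠ 0 → ∃ i, inner ℝ (e i : E n) w ≠ 0) {q : ℝ} (hq : 0 < q) (hq₁ : q < 1)
    {m : ι → ℝ} (hm : ∀ i, 0 < m i) :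
    ∃ c : ι → ℝ, (∀ i, 0 < c i) ∧ ∀ i, (sphereMeasure n).real
      (dominanceCell (fun i (v : S n) => |inner ℝ (c i • (e i : E n)) (v : E n)|) i) =
        m i * c i ^ q := by
  obtain ⟨s, hs, hsq⟩ : ∃ s : ℝ, 1 < s ∧ s < q⁻¹ := exists_between (one_lt_inv₀ hq |>.2 hq₁)
  have hw (i : ι) : Continuous fun v : S n => |inner ℝ (e i : E n) (v : E n)| ^ q :=
    Continuous.rpow_const (by fun_prop) fun _ => .inr hq.le
  have hex (v : S n) : ∃ i, 0 < |inner ℝ (e i : E n) (v : E n)| ^ q := by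
    obtain ⟨i, hi⟩ := hspan v (ne_zero_of_mem_unit_sphere v)
    exact ⟨i, by positivity⟩
  have hpos (i : ι) : ∀ᵐ v : S n ∂sphereMeasure n, 0 < |inner ℝ (e i : E n) (v : E n)| ^ q := by
    filter_upwards [ae_toSphere_inner_ne_zero volume (ne_zero_of_mem_unit_sphere (e i))] with v hv
    positivity
  have hint (i : ι) : Integrable (fun v : S n => (|inner ℝ (e i : E n) (v : E n)| ^ q) ^ (-s))
      (sphereMeasure n) := by
    have hqs : q * s < 1 := (lt_inv_mul_iff₀ hq).1 (by rwa [mul_one])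
    simpa only [← Real.rpow_mul (abs_nonneg _), mul_neg] using
      integrable_abs_inner_rpow_neg volume (e i) (by positivity) hqs
  obtain ⟨a, ha, hcell⟩ := exists_pos_measureReal_dominanceCell_eq hw
    (fun _ _ => Real.rpow_nonneg (abs_nonneg _) q) hex hpos hs hint
    (fun a ha i j hij => ae_mul_abs_inner_rpow_ne (he.ne hij) (hneg i j) (ha i) (ha j) hq) hm
  refine ⟨fun i => a i ^ q⁻¹, fun i => Real.rpow_pos_of_pos (ha i) _, fun i => ?_⟩
  rw [Real.rpow_inv_rpow (ha i).le hq.ne', ← hcell,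
    ← dominanceCell_rpow (fun _ _ => abs_nonneg _) hq]
  simp only [mul_abs_inner_rpow (ha _) hq]

end Weights

section DiscreteMeasure

variable {n : ℕ} {μ : Measure (S n)}

theorem IsDiscreteMeasure.exists_finset_integral_eq_sum [IsFiniteMeasure μ]
    (hμd : IsDiscreteMeasure μ) :
    ∃ T : Finset (S n), (∀ u, u ∈ T ↔ μ.real {u} ≠ 0) ∧
      ∀ f : S n → ℝ, ∫ u, f u ∂μ = ∑ u ∈ T, μ.real {u} * f u := by
  classical
  obtain ⟨F, hF, hF₀⟩ := hμd
  refine ⟨hF.toFinset.filter fun u => μ.real {u} ≠ 0, fun u => ?_, fun f => ?_⟩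
  · simp only [Finset.mem_filter, Finite.mem_toFinset, and_iff_right_iff_imp]
    intro hu
    by_contra huF
    exact hu ((measureReal_eq_zero_iff).2 (measure_mono_null (singleton_subset_iff.2 huF) hF₀))
  · have hrestrict : μ.restrict (hF.toFinset : Set (S n)) = μ :=
      Measure.restrict_eq_self_of_ae_mem ((hF.coe_toFinset).symm ▸ hF₀)
    rw [Finset.sum_filter_of_ne fun u _ => left_ne_zero_of_mul]
    conv_lhs => rw [← hrestrict]
    rw [setIntegral_finset _ (IntegrableOn.finset)]
    simp

theorem IsEvenMeasure.measureReal_singleton_neg (hμe : IsEvenMeasure μ) (u : S n) :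
    μ.real {-u} = μ.real {u} := by
  rw [measureReal_def, measureReal_def, ← hμe {u} (measurableSet_singleton u)]
  congr 2
  ext v
  exact neg_eq_iff_eq_neg.symm

theorem exists_forall_inner_ne_zero [Nonempty (S n)] (T : Finset (S n)) :
    ∃ w : S n, ∀ u ∈ T, inner ℝ (u : E n) (w : E n) ≠ 0 :=
  (eventually_all_finset T |>.2 fun u _ =>
    ae_toSphere_inner_ne_zero volume (ne_zero_of_mem_unit_sphere u)).exists

theorem exists_finset_integral_eq_sum_add_neg [Nonempty (S n)] [IsFiniteMeasure μ]
    (hμe : IsEvenMeasure μ) (hμd : IsDiscreteMeasure μ) :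
    ∃ H : Finset (S n), (∀ u ∈ H, 0 < μ.real {u}) ∧ (∀ u ∈ H, -u ∉ H) ∧
      ∀ f : S n → ℝ, ∫ u, f u ∂μ = ∑ u ∈ H, μ.real {u} * (f u + f (-u)) := by
  classical
  obtain ⟨T, hT, hint⟩ := hμd.exists_finset_integral_eq_sum
  obtain ⟨w, hw⟩ := exists_forall_inner_ne_zero T
  refine ⟨T.filter fun u => 0 < inner ℝ (u : E n) (w : E n), fun u hu => ?_, fun u hu hu' => ?_,
    fun f => ?_⟩
  · exact measureReal_nonneg.lt_of_ne' ((hT u).1 (Finset.mem_filter.1 hu).1)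
  · have hpos := (Finset.mem_filter.1 hu).2
    have hneg := (Finset.mem_filter.1 hu').2
    rw [coe_neg_sphere, inner_neg_left] at hneg
    exact (neg_pos.1 hneg).asymm hpos
  · rw [hint, ← Finset.sum_filter_add_sum_filter_not T fun u => 0 < inner ℝ (u : E n) (w : E n)]
    simp only [mul_add, Finset.sum_add_distrib]
    congr 1
    have hneg (u : S n) (hu : u ∈ T) : -u ∈ T := by
      rwa [hT, hμe.measureReal_singleton_neg, ← hT]
    refine Finset.sum_nbij' (fun u => -u) (fun u => -u) (fun u hu => ?_) (fun u hu => ?_)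
      (fun _ _ => neg_neg _) (fun _ _ => neg_neg _) fun u _ => ?_
    · obtain ⟨huT, hu⟩ := Finset.mem_filter.1 hu
      refine Finset.mem_filter.2 ⟨hneg u huT, ?_⟩
      rw [coe_neg_sphere, inner_neg_left, neg_pos]
      exact (not_lt.1 hu).lt_of_ne (hw u huT)
    · obtain ⟨huT, hu⟩ := Finset.mem_filter.1 hu
      refine Finset.mem_filter.2 ⟨hneg u huT, ?_⟩
      rw [coe_neg_sphere, inner_neg_left, neg_pos]
      exact hu.asymm
    · rw [hμe.measureReal_singleton_neg, neg_neg]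

end DiscreteMeasure

section Existence

variable {n : ℕ} {μ : Measure (S n)} {p : ℝ}

theorem isBodyE_convexHull_range_symmetric {ι : Type*} [Finite ι] [Nonempty ι] {ζ : ι → E n}
    (hspan : ∀ w : E n, w ≠ 0 → ∃ i, inner ℝ (ζ i) w ≠ 0) :
    IsBodyE (convexHull ℝ (range (Sum.elim ζ (-ζ)))) := by
  refine isBodyE_convexHull_range ?_ fun w hw => ?_
  · rintro (i | i)
    · exact ⟨.inr i, rfl⟩
    · exact ⟨.inl i, (neg_neg _).symm⟩
  · obtain ⟨i, hi⟩ := hspan w hw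
    exact ⟨.inl i, hi⟩

theorem exists_polytope_isLpIntegralCurvature [Nonempty (S n)] {ι : Type*} [Fintype ι] [Nonempty ι]
    {e : ι → S n} (he : Function.Injective e) (hneg : ∀ i j, e i ≠ -e j)
    (hspan : ∀ w : E n, w ≠ 0 → ∃ i, inner ℝ (e i : E n) w ≠ 0) (hp₁ : -1 < p) (hp₀ : p < 0)
    {m : ι → ℝ} (hm : ∀ i, 0 < m i)
    (hμ : ∀ f : S n → ℝ, ∫ u, f u ∂μ = ∑ i, m i * (f (e i) + f (-e i))) :
    ∃ K : Set (E n), IsBodyE K ∧ IsPolytope K ∧ IsLpIntegralCurvature p K μ := by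
  classical
  obtain ⟨c, hc, hcell⟩ := exists_pos_measureReal_dominanceCell_abs_inner_eq he hneg hspan
    (neg_pos.2 hp₀) (neg_lt.1 hp₁) fun i => mul_pos two_pos (hm i)
  let ζ : ι → E n := fun i => c i • (e i : E n)
  have hζ (i : ι) : ζ i ≠ 0 := smul_ne_zero (hc i).ne' (ne_zero_of_mem_unit_sphere _)
  have hK : IsBodyE (convexHull ℝ (range (Sum.elim ζ (-ζ)))) := by
    refine isBodyE_convexHull_range_symmetric fun w hw => (hspan w hw).imp fun i hi => ?_
    rw [real_inner_smul_left]
    exact mul_ne_zero (hc i).ne' hi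
  refine ⟨_, hK, ⟨Finset.univ.image (Sum.elim ζ (-ζ)), by simp⟩, ?_⟩
  refine (isLpIntegralCurvature_convexHull_iff hp₀ (injective_sumElim_smul_sphere he hneg hc)
    hK.isBodyO).2 fun Q _ => ?_
  rw [hμ, Fintype.sum_sum_type, ← Finset.sum_add_distrib]
  refine Finset.sum_congr rfl fun i _ => ?_
  obtain ⟨hanti, hdouble⟩ := measureReal_normalCell_symmetric (hζ i)
  have hmass : (sphereMeasure n).real (normalCell (Sum.elim ζ (-ζ)) (.inl i)) * c i ^ p = m i := by
    have hcancel : c i ^ (-p) * c i ^ p = 1 := by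
      rw [← Real.rpow_add (hc i), neg_add_cancel, Real.rpow_zero]
    linear_combination (c i ^ p / 2) * (hdouble.trans (hcell i)) + m i * hcancel
  have hvertex (u : S n) : gauge Q (c i • (u : E n)) ^ p = c i ^ p * gauge Q u ^ p := by
    rw [gauge_smul_of_nonneg (hc i).le, smul_eq_mul, Real.mul_rpow (hc i).le (gauge_nonneg _)]
  rw [Sum.elim_inl, Sum.elim_inr, Pi.neg_apply, ← smul_neg, ← coe_neg_sphere, hvertex, hvertex,
    hanti, ← hmass]
  ring

theorem exists_isBodyE_isPolytope_isLpIntegralCurvature [IsFiniteMeasure μ] (hp₁ : -1 < p)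
    (hp₀ : p < 0) (hμ₀ : μ ≠ 0) (hμe : IsEvenMeasure μ) (hμd : IsDiscreteMeasure μ)
    (hμ : ∀ w : E n, w ≠ 0 → μ (greatSubsphere w)ᶜ ≠ 0) :
    ∃ K : Set (E n), IsBodyE K ∧ IsPolytope K ∧ IsLpIntegralCurvature p K μ := by
  classical
  have : Nonempty (S n) := not_isEmpty_iff.1 fun _ => hμ₀ (Measure.eq_zero_of_isEmpty μ)
  obtain ⟨H, hHpos, hHneg, hint⟩ := exists_finset_integral_eq_sum_add_neg hμe hμd
  have hspan (w : E n) (hw : w ≠ 0) : ∃ u : H, inner ℝ ((u : S n) : E n) w ≠ 0 := by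
    by_contra! hzero
    have hmeas : MeasurableSet (greatSubsphere w)ᶜ :=
      (isClosed_eq (by fun_prop) continuous_const).measurableSet.compl
    refine hμ w hw ((measureReal_eq_zero_iff).1 ?_)
    rw [← integral_indicator_one hmeas, hint]
    refine Finset.sum_eq_zero fun u hu => ?_
    simp [greatSubsphere, hzero ⟨u, hu⟩]
  obtain ⟨w⟩ := ‹Nonempty (S n)›
  have : Nonempty H := ⟨(hspan w (ne_zero_of_mem_unit_sphere w)).choose⟩
  refine exists_polytope_isLpIntegralCurvature Subtype.val_injective
    (fun u v huv => hHneg v v.2 (huv ▸ u.2)) hspan hp₁ hp₀ (fun u => hHpos u u.2) fun f => ?_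
  rw [hint, ← Finset.sum_coe_sort]

end Existence

end LpAleksandrov

end

theorem theorem1p3 (n : ℕ) (p : ℝ) (hp₁ : -1 < p) (hp₀ : p < 0)
    (μ : MeasureTheory.Measure (LpAleksandrov.S n)) [MeasureTheory.IsFiniteMeasure μ]
    (hμ₀ : μ ≠ 0) (hμe : LpAleksandrov.IsEvenMeasure μ)
    (hμd : LpAleksandrov.IsDiscreteMeasure μ) :
    (∃ K : Set (LpAleksandrov.E n), LpAleksandrov.IsBodyE K ∧ LpAleksandrov.IsPolytope K ∧
        LpAleksandrov.IsLpIntegralCurvature p K μ) ↔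
      ∀ w : LpAleksandrov.E n, w ≠ 0 → μ (LpAleksandrov.greatSubsphere w)ᶜ ≠ 0 := by
  constructor
  · rintro ⟨K, hK, hKp, hμK⟩ w hw
    exact hKp.measure_compl_greatSubsphere_ne_zero hK.isBodyO hp₀ hμK hw
  · exact LpAleksandrov.exists_isBodyE_isPolytope_isLpIntegralCurvature hp₁ hp₀ hμ₀ hμe hμd
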